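/- Let $\mathbb{H}$ be a real Hilbert space with a Hilbert basis $(e_i)_{i\ge 1}$ indexed by the positive integers, and let $\mathcal{H}=\mathbb{R}\oplus\mathbb{H}$ with the inner product $\langle (s,x),(t,y)\rangle = st+\langle x,y\rangle$ and the Hilbert basis formed by $e_0=(1,0)$ and the vectors $(0,e_i)$, again written $e_i$, $i\ge 1$. Let $L_{HS}(\mathcal{H})$ be the Hilbert space of Hilbert–Schmidt operators of $\mathcal{H}$, with norm $|A|_{HS}=\big(\sum_{i\ge 0}|Ae_i|^2\big)^{1/2}$, and let $e_{ij}$ be the operator $x\mapsto\langle e_j,x\rangle e_i$. Let $\mathfrak{h}$ (resp. $\mathfrak{s}$) be the closed subspace of $L_{HS}(\mathcal{H})$ generated by the operators $e_{0i}+e_{i0}$, $i\ge 1$ (resp. $e_{ij}-e_{ji}$, $1\le i<j$), and let $\mathfrak{g}=\mathfrak{h}\oplus\mathfrak{s}$. Let $SO_{HS}(\mathbb{H},1)$ be the Cameron–Martin group of $\mathfrak{g}$: the set of the invertible bounded operators $A$ of $\mathcal{H}$ with $d(A,\mathrm{Id})<\infty$, where $d(A,B)$ is the infimum (which is $\infty$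 if there is no such path) of the lengths $\int_0^1|\gamma(s)^{-1}\dot\gamma(s)|_{HS}\,ds$ of the piecewise $C^1$ paths $\gamma$ from $[0,1]$ to the group $GL(\mathcal{H})$ of invertible bounded operators, with $\gamma(0)=A$ and $\gamma(1)=B$, such that $\gamma^{-1}\dot\gamma$ takes its values in $\mathfrak{g}$ and is piecewise continuous for $|\cdot|_{HS}$. Then for every $A\in SO_{HS}(\mathbb{H},1)$ there exist $U\in\mathfrak{h}$, a set $J\subset\mathbb{N}$ (finite, possibly empty, or infinite), a family $(B_j)_{j\in J}$ of finite-rank elements of $\mathfrak{s}$, and a non-increasing family $(\theta_j)_{j\in J}$ of real numbers with $0<\theta_j\le\pi$, such that (i) $[B_k,B_j]=0$ for all $k\neq j$ in $J$; (ii) $A=\Big(\prod_{j\in J}\mathrm{Exp}(\theta_jB_j)\Big)\,\mathrm{Exp}(U)$, where, if $J$ is infinite, the product is the limit $P$ of the partial products $P_n=\prod_{j\in J,\,j<n}\mathrm{Exp}(\theta_jB_j)$ in the sense that $P_n-P$ is Hilbert–Schmidt for all $n$ and $|P_n-P|_{HS}\to0$. -/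

import Mathlib

namespace HSLorentz

/-- The Hilbert space `ℝ ⊕ H` with the inner product `⟪(s, x), (t, y)⟫ = s t + ⟪x, y⟫`. -/
def Space (H : Type*) [NormedAddCommGroup H] [InnerProductSpace ℝ H] : Type _ :=
  WithLp 2 (ℝ × H)

noncomputable instance (H : Type*) [NormedAddCommGroup H] [InnerProductSpace ℝ H] :
    NormedAddCommGroup (Space H) :=
  inferInstanceAs (NormedAddCommGroup (WithLp 2 (ℝ × H)))

noncomputable instance (H : Type*) [NormedAddCommGroup H] [InnerProductSpace ℝ H] :
    InnerProductSpace ℝ (Space H) :=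
  inferInstanceAs (InnerProductSpace ℝ (WithLp 2 (ℝ × H)))

instance (H : Type*) [NormedAddCommGroup H] [InnerProductSpace ℝ H] [CompleteSpace H] :
    CompleteSpace (Space H) :=
  inferInstanceAs (CompleteSpace (WithLp 2 (ℝ × H)))

/-- The vector `(s, x)` of `ℝ ⊕ H`. -/
def Space.mk {H : Type*} [NormedAddCommGroup H] [InnerProductSpace ℝ H] (s : ℝ) (x : H) :
    Space H :=
  WithLp.toLp 2 (s, x)

theorem Space.inner_mk {H : Type*} [NormedAddCommGroup H] [InnerProductSpace ℝ H]
    (s t : ℝ) (x y : H) :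
    inner ℝ (Space.mk s x) (Space.mk t y) = s * t + inner ℝ x y := by
  change inner ℝ (WithLp.toLp 2 (s, x)) (WithLp.toLp 2 (t, y)) = _
  rw [WithLp.prod_inner_apply]
  simp [mul_comm]

/-- Bounded operators of `ℝ ⊕ H`, a Banach algebra for the operator norm. -/
abbrev Op (H : Type*) [NormedAddCommGroup H] [InnerProductSpace ℝ H] : Type _ :=
  Space H →L[ℝ] Space H

noncomputable section

variable {H : Type*} [NormedAddCommGroup H] [InnerProductSpace ℝ H]

/-- The Hilbert basis of `ℝ ⊕ H` given by a Hilbert basis `e` of `H`: the vector of index `0` is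
`(1, 0)` and the vector of index `i + 1` is `(0, e i)`. -/
def stdBasis (e : HilbertBasis ℕ ℝ H) : ℕ → Space H
  | 0 => Space.mk 1 0
  | i + 1 => Space.mk 0 (e i)

/-- Hilbert–Schmidt operators: `∑ |A e_i|² < ∞`. -/
def IsHS (e : HilbertBasis ℕ ℝ H) (A : Op H) : Prop :=
  Summable fun i => ‖A (stdBasis e i)‖ ^ 2

/-- The Hilbert–Schmidt norm (meaningful on Hilbert–Schmidt operators only). -/
def hsNorm (e : HilbertBasis ℕ ℝ H) (A : Op H) : ℝ :=
  Real.sqrt (∑' i, ‖A (stdBasis e i)‖ ^ 2)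

/-- The closure, in the space of Hilbert–Schmidt operators with the Hilbert–Schmidt norm, of a set
of Hilbert–Schmidt operators. -/
def hsClosure (e : HilbertBasis ℕ ℝ H) (S : Set (Op H)) : Set (Op H) :=
  {X | IsHS e X ∧ ∀ ε > 0, ∃ Y ∈ S, IsHS e Y ∧ hsNorm e (X - Y) < ε}

/-- The elementary matrix with `1` at the place `(i, j)`: the operator `x ↦ ⟪e_j, x⟫ e_i`. -/
def elem (e : HilbertBasis ℕ ℝ H) (i j : ℕ) : Op H :=
  InnerProductSpace.rankOne ℝ (stdBasis e i) (stdBasis e j)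

/-- `𝔥`: the closed subspace generated by `U_i = e_{0i} + e_{i0}`, `0 < i`. -/
def hSpace (e : HilbertBasis ℕ ℝ H) : Set (Op H) :=
  hsClosure e (Submodule.span ℝ {X | ∃ i : ℕ, 0 < i ∧ X = elem e 0 i + elem e i 0})

/-- `𝔰`: the closed subspace generated by `Ω_{ij} = e_{ij} - e_{ji}`, `0 < i < j`. -/
def sSpace (e : HilbertBasis ℕ ℝ H) : Set (Op H) :=
  hsClosure e (Submodule.span ℝ {X | ∃ i j : ℕ, 0 < i ∧ i < j ∧ X = elem e i j - elem e j i})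

/-- `𝔤 = 𝔥 + 𝔰`. -/
def gSpace (e : HilbertBasis ℕ ℝ H) : Set (Op H) :=
  {X | ∃ Y ∈ hSpace e, ∃ Z ∈ sSpace e, X = Y + Z}

/-- `ω` is continuous on `I` for the Hilbert–Schmidt norm. -/
def HSContinuousOn (e : HilbertBasis ℕ ℝ H) (ω : ℝ → Op H) (I : Set ℝ) : Prop :=
  ∀ s ∈ I, ∀ ε > 0, ∃ δ > 0, ∀ r ∈ I, |r - s| < δ →
    IsHS e (ω r - ω s) ∧ hsNorm e (ω r - ω s) < ε

/-- Piecewise `C¹` paths `γ` from `[0, 1]` to the group of invertible bounded operators (with the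
operator norm) such that `γ⁻¹ γ̇` takes its values in `𝔤` and is piecewise continuous for the
Hilbert–Schmidt norm. On each closed piece of the subdivision `τ 0 < ⋯ < τ n`, `ω = γ⁻¹ γ̇`. -/
def IsAdmissiblePath (e : HilbertBasis ℕ ℝ H) (γ : ℝ → Op H) : Prop :=
  (∀ s ∈ Set.Icc (0 : ℝ) 1, IsUnit (γ s)) ∧
  ∃ (n : ℕ) (τ : ℕ → ℝ), τ 0 = 0 ∧ τ n = 1 ∧ (∀ i < n, τ i < τ (i + 1)) ∧
    ∀ i < n, ∃ ω : ℝ → Op H,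
      (∀ s ∈ Set.Icc (τ i) (τ (i + 1)), ω s ∈ gSpace e) ∧
      HSContinuousOn e ω (Set.Icc (τ i) (τ (i + 1))) ∧
      ∀ s ∈ Set.Icc (τ i) (τ (i + 1)),
        HasDerivWithinAt γ (γ s * ω s) (Set.Icc (τ i) (τ (i + 1))) s

/-- The length `∫₀¹ |γ⁻¹ γ̇|_HS` of an admissible path. -/
def pathLength (e : HilbertBasis ℕ ℝ H) (γ : ℝ → Op H) : ENNReal :=
  ∫⁻ s in Set.Icc (0 : ℝ) 1, ENNReal.ofReal (hsNorm e (Ring.inverse (γ s) * deriv γ s))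

/-- The infimum of the lengths of the admissible paths from `A` to `B`; it is `∞` if there is no
such path. -/
def cmDist (e : HilbertBasis ℕ ℝ H) (A B : Op H) : ENNReal :=
  ⨅ (γ : ℝ → Op H) (_ : IsAdmissiblePath e γ ∧ γ 0 = A ∧ γ 1 = B), pathLength e γ

/-- The Hilbert–Schmidt orthochronous Lorentz group `SO_HS(H, 1)`: the Cameron–Martin group of the
ascending sequence of the groups `SO₀(n, 1)`, that is, the invertible operators at finite distance
from the identity. -/
def SOHS (e : HilbertBasis ℕ ℝ H) : Set (Op H) :=
  {A | IsUnit A ∧ cmDist e A 1 < ⊤}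

/-- The finite product of the `F j`, `j ∈ J`, `j < n`, in increasing order of `j`. -/
def partialProd (J : Set ℕ) (F : ℕ → Op H) (n : ℕ) : Op H :=
  ((List.range n).map (J.mulIndicator F)).prod

/-- `P = ∏_{j ∈ J} F j`, with convergence of the finite products in Hilbert–Schmidt norm. -/
def HasHSProd (e : HilbertBasis ℕ ℝ H) (J : Set ℕ) (F : ℕ → Op H) (P : Op H) : Prop :=
  (∀ n, IsHS e (partialProd J F n - P)) ∧
  Filter.Tendsto (fun n => hsNorm e (partialProd J F n - P)) Filter.atTop (nhds 0)

end

end HSLorentz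

/-!
The decomposition is `A = R * Exp U` with `U` the generator of a boost and `R` an orthogonal
operator fixing `e_0`, followed by the decomposition of `R` into its rotations.

Along a path with `γ⁻¹ γ̇ ∈ 𝔤` ending at the identity, `γ - 1` is Hilbert–Schmidt
(`isHS_sub_of_path`), the Lorentz form is preserved because `𝔤` consists of infinitesimal isometries
(`lorentz_skew_of_mem_gSpace`), and the entry `⟪e_0, γ e_0⟫`, whose square is at least `1`, remains
positive. The polar decomposition is then explicit, without functional calculus: the boost `Exp U`
is the one with the same first row as `A`, and `A * Exp (-U)` preserves both the Lorentz form and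
`e_0`, so it is orthogonal (`IsProperLorentz.exists_polar`).

The operator `gap R = (R - 1)* (R - 1) = 2 - R - R*` is compact and self-adjoint, and commutes with
`R`. On its eigenspace for `μ = 2 - 2 cos θ`, of finite dimension if `μ ≠ 0`, one has
`R + R* = 2 cos θ`, so that `R = cos θ + sin θ B` with `B = (R - R*) / (2 sin θ)`, a skew-adjoint
operator of square `-1`, if `0 < θ < π`. Hence `Exp (θ B)` is `R` on the eigenspace and the identity
on its orthogonal complement. The partial products differ from `R` by the product of `R - 1` with a
projection decreasing strongly to a projection that kills `R - 1`, and dominated convergence for the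
Hilbert–Schmidt norm concludes (`IsRotation.exists_hasHSProd`).

For `θ = π` the operator `R` is `-1` on the eigenspace, and a complex structure `B` exists there
only if the dimension is even. This is where the connectedness of the group enters. Since no
determinant is defined on all Hilbert–Schmidt perturbations of the identity, it is replaced by the
sign of the determinants of the compressions to large finite-dimensional subspaces, which is
constant along paths of invertible operators of the form `1 + compact` (`sameSign_of_path`). So this
sign is positive for `A`, for `R`, and, by a deformation of `R` on the complement of the eigenspace,
for the operator that is `-1` on the eigenspace and `1` on its complement; for the latter it is the
parity of the dimension (`even_finrank_eigenspace_gap`).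
-/

namespace HSLorentz

open Filter Topology

/-! ### Hilbert–Schmidt operators -/

section HilbertSchmidt

theorem norm_stdBasis {H : Type*} [NormedAddCommGroup H] [InnerProductSpace ℝ H]
    (e : HilbertBasis ℕ ℝ H) (i : ℕ) : ‖stdBasis e i‖ = 1 := by
  have h : ‖stdBasis e i‖ ^ 2 = 1 := by
    rw [← real_inner_self_eq_norm_sq]
    cases i <;> rw [stdBasis, Space.inner_mk] <;>
      simp [e.orthonormal.1]
  exact (pow_eq_one_iff_of_nonneg (norm_nonneg _) two_ne_zero).mp h

theorem orthonormal_stdBasis {H : Type*} [NormedAddCommGroup H] [InnerProductSpace ℝ H]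
    (e : HilbertBasis ℕ ℝ H) : Orthonormal ℝ (stdBasis e) := by
  refine ⟨norm_stdBasis e, ?_⟩
  rintro (_ | i) (_ | j) hij
  · exact absurd rfl hij
  · simp [stdBasis, Space.inner_mk]
  · simp [stdBasis, Space.inner_mk]
  · simpa [stdBasis, Space.inner_mk] using e.orthonormal.2 (fun h => hij (by rw [h]))

theorem span_stdBasis_orthogonal {H : Type*} [NormedAddCommGroup H] [InnerProductSpace ℝ H]
    (e : HilbertBasis ℕ ℝ H) : (Submodule.span ℝ (Set.range (stdBasis e)))ᗮ = ⊥ := by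
  rw [eq_bot_iff]
  intro x hx
  rw [Submodule.mem_orthogonal] at hx
  have hx' (i : ℕ) : inner ℝ (stdBasis e i) x = 0 := hx _ (Submodule.subset_span ⟨i, rfl⟩)
  obtain ⟨s, y, rfl⟩ : ∃ s y, x = Space.mk s y := ⟨x.fst, x.snd, rfl⟩
  have hs : s = 0 := by simpa [stdBasis, Space.inner_mk] using hx' 0
  have hy : y = 0 := by
    have h (i : ℕ) : e.repr y i = 0 := by
      rw [e.repr_apply_apply]
      simpa [stdBasis, Space.inner_mk] using hx' (i + 1)
    apply e.repr.injective
    ext i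
    simp [h]
  subst hs hy
  rfl

section

variable {H : Type*} [NormedAddCommGroup H] [InnerProductSpace ℝ H]
  {e : HilbertBasis ℕ ℝ H} {A B : Op H}

theorem isHS_of_le {C : ℝ} (hA : IsHS e A) (h : ∀ i, ‖B (stdBasis e i)‖ ≤ C * ‖A (stdBasis e i)‖) :
    IsHS e B := by
  refine Summable.of_nonneg_of_le (fun i => by positivity) (fun i => ?_) (hA.mul_left (C ^ 2))
  rw [← mul_pow]
  exact pow_le_pow_left₀ (norm_nonneg _) (h i) 2

theorem IsHS.add (hA : IsHS e A) (hB : IsHS e B) : IsHS e (A + B) := by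
  refine Summable.of_nonneg_of_le (fun i => by positivity) (fun i => ?_)
    ((Summable.add hA hB).mul_left 2)
  refine (pow_le_pow_left₀ (norm_nonneg _) (norm_add_le _ _) 2).trans ?_
  exact add_sq_le

theorem IsHS.smul (c : ℝ) (hA : IsHS e A) : IsHS e (c • A) :=
  isHS_of_le (C := |c|) hA fun i => by simp [norm_smul]

theorem IsHS.sub (hA : IsHS e A) (hB : IsHS e B) : IsHS e (A - B) := by
  rw [sub_eq_add_neg, ← neg_one_smul ℝ B]
  exact hA.add (hB.smul _)

theorem IsHS.mul_left (hA : IsHS e A) (X : Op H) : IsHS e (X * A) :=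
  isHS_of_le (C := ‖X‖) hA fun _ => X.le_opNorm _

theorem hsNorm_nonneg (e : HilbertBasis ℕ ℝ H) (A : Op H) : 0 ≤ hsNorm e A := Real.sqrt_nonneg _

/-- The orthogonal projection on the span of the first `n` vectors of the standard basis. -/
noncomputable def stdProj (e : HilbertBasis ℕ ℝ H) (n : ℕ) : Op H :=
  ∑ i ∈ Finset.range n, elem e i i

theorem stdProj_apply (e : HilbertBasis ℕ ℝ H) (n : ℕ) (x : Space H) :
    stdProj e n x = ∑ i ∈ Finset.range n, inner ℝ (stdBasis e i) x • stdBasis e i := by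
  simp [stdProj, elem]

theorem isHS_sum {ι : Type*} (s : Finset ι) {F : ι → Op H} (h : ∀ i ∈ s, IsHS e (F i)) :
    IsHS e (∑ i ∈ s, F i) := by
  classical
  induction s using Finset.induction_on with
  | empty => simp [IsHS]
  | insert i s hi ih =>
    rw [Finset.sum_insert hi]
    exact (h i (Finset.mem_insert_self i s)).add (ih fun j hj => h j (Finset.mem_insert_of_mem hj))

/-- Dominated convergence for the Hilbert–Schmidt norm. -/
theorem tendsto_hsNorm_zero {F : ℕ → Op H} (hA : IsHS e A)
    (hle : ∀ n i, ‖F n (stdBasis e i)‖ ≤ ‖A (stdBasis e i)‖)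
    (hlim : ∀ i, Tendsto (fun n => F n (stdBasis e i)) atTop (𝓝 0)) :
    Tendsto (fun n => hsNorm e (F n)) atTop (𝓝 0) := by
  have h : Tendsto (fun n => ∑' i, ‖F n (stdBasis e i)‖ ^ 2) atTop (𝓝 (∑' _ : ℕ, (0 : ℝ))) := by
    refine tendsto_tsum_of_dominated_convergence (bound := fun i => ‖A (stdBasis e i)‖ ^ 2) hA
      (fun i => ?_) (Eventually.of_forall fun n i => ?_)
    · simpa using ((hlim i).norm.pow 2)
    · rw [Real.norm_of_nonneg (by positivity)]
      exact pow_le_pow_left₀ (norm_nonneg _) (hle n i) 2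
  simpa [hsNorm, Function.comp_def] using (Real.continuous_sqrt.tendsto _).comp h

theorem stdProj_stdBasis (e : HilbertBasis ℕ ℝ H) (n i : ℕ) :
    stdProj e n (stdBasis e i) = if i < n then stdBasis e i else 0 := by
  simp [stdProj_apply, orthonormal_iff_ite.mp (orthonormal_stdBasis e), ite_smul]

/-- The square truncation as a combination of elementary matrices. -/
theorem truncation_eq_sum (e : HilbertBasis ℕ ℝ H) (A : Op H) (n : ℕ) :
    stdProj e n * A * stdProj e n = ∑ i ∈ Finset.range n, ∑ j ∈ Finset.range n,
      inner ℝ (stdBasis e i) (A (stdBasis e j)) • elem e i j := by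
  have h (i j : ℕ) : elem e i i * A * elem e j j =
      inner ℝ (stdBasis e i) (A (stdBasis e j)) • elem e i j := by
    ext x
    simp [elem, smul_smul, mul_comm]
  simp only [stdProj, Finset.sum_mul, Finset.mul_sum, h]
  exact Finset.sum_comm

theorem isCompactOperator_rankOne (x y : Space H) :
    IsCompactOperator (InnerProductSpace.rankOne ℝ x y : Op H) := by
  have h : IsCompactOperator (innerSL ℝ y : Space H →L[ℝ] ℝ) :=
    isCompactOperator_of_locallyCompactSpace_dom (M₂ := ℝ) _
  exact h.clm_comp (ContinuousLinearMap.toSpanSingleton ℝ x)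

end

variable {H : Type*} [NormedAddCommGroup H] [InnerProductSpace ℝ H] [CompleteSpace H]

/-- The standard basis of `ℝ ⊕ H`, as a Hilbert basis. -/
noncomputable def stdHilbertBasis (e : HilbertBasis ℕ ℝ H) : HilbertBasis ℕ ℝ (Space H) :=
  HilbertBasis.mkOfOrthogonalEqBot (orthonormal_stdBasis e) (span_stdBasis_orthogonal e)

@[simp]
theorem coe_stdHilbertBasis (e : HilbertBasis ℕ ℝ H) : ⇑(stdHilbertBasis e) = stdBasis e :=
  HilbertBasis.coe_mkOfOrthogonalEqBot _ _

variable {e : HilbertBasis ℕ ℝ H} {A B : Op H}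

theorem hasSum_inner_stdBasis_sq (e : HilbertBasis ℕ ℝ H) (x : Space H) :
    HasSum (fun i => inner ℝ (stdBasis e i) x ^ 2) (‖x‖ ^ 2) := by
  have h := (stdHilbertBasis e).hasSum_inner_mul_inner x x
  rw [real_inner_self_eq_norm_sq] at h
  simpa [real_inner_comm x, sq] using h

theorem hasSum_inner_smul_stdBasis (e : HilbertBasis ℕ ℝ H) (x : Space H) :
    HasSum (fun i => inner ℝ (stdBasis e i) x • stdBasis e i) x := by
  simpa [HilbertBasis.repr_apply_apply] using (stdHilbertBasis e).hasSum_repr x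

theorem isHS_rankOne (e : HilbertBasis ℕ ℝ H) (x y : Space H) :
    IsHS e (InnerProductSpace.rankOne ℝ x y) := by
  have h := (hasSum_inner_stdBasis_sq e y).summable.mul_right (‖x‖ ^ 2)
  refine h.congr fun i => ?_
  simp [norm_smul, mul_pow, real_inner_comm]

theorem isHS_starProjection (e : HilbertBasis ℕ ℝ H) (V : Submodule ℝ (Space H))
    [FiniteDimensional ℝ V] : IsHS e V.starProjection := by
  rw [(stdOrthonormalBasis ℝ V).starProjection_eq_sum_rankOne]
  exact isHS_sum _ fun i _ => isHS_rankOne e _ _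

/-- The Hilbert–Schmidt norm dominates the operator norm: Cauchy–Schwarz applied to the expansion
of `x` in the basis. -/
theorem IsHS.norm_le_hsNorm (hA : IsHS e A) : ‖A‖ ≤ hsNorm e A := by
  refine A.opNorm_le_bound (hsNorm_nonneg e A) fun x => ?_
  have h := A.hasSum (hasSum_inner_smul_stdBasis e x)
  simp only [map_smul] at h
  refine le_of_tendsto h.norm (Eventually.of_forall fun s => ?_)
  calc ‖∑ i ∈ s, inner ℝ (stdBasis e i) x • A (stdBasis e i)‖
      ≤ ∑ i ∈ s, ‖A (stdBasis e i)‖ * |inner ℝ (stdBasis e i) x| := by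
        refine (norm_sum_le _ _).trans (Finset.sum_le_sum fun i _ => ?_)
        rw [norm_smul, Real.norm_eq_abs, mul_comm]
    _ ≤ √(∑ i ∈ s, ‖A (stdBasis e i)‖ ^ 2) * √(∑ i ∈ s, |inner ℝ (stdBasis e i) x| ^ 2) :=
        Real.sum_mul_le_sqrt_mul_sqrt _ _ _
    _ ≤ hsNorm e A * ‖x‖ := by
        refine mul_le_mul (Real.sqrt_le_sqrt (hA.sum_le_tsum s fun i _ => by positivity)) ?_
          (Real.sqrt_nonneg _) (hsNorm_nonneg e A)
        refine Real.sqrt_le_iff.mpr ⟨norm_nonneg _, ?_⟩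
        simp only [sq_abs]
        exact sum_le_hasSum s (fun i _ => sq_nonneg _) (hasSum_inner_stdBasis_sq e x)

theorem isStarProjection_stdProj (e : HilbertBasis ℕ ℝ H) (n : ℕ) :
    IsStarProjection (stdProj e n) := by
  constructor
  · ext x
    have h (i) (hi : i ∈ Finset.range n) : stdProj e n (stdBasis e i) = stdBasis e i := by
      rw [stdProj_stdBasis, if_pos (Finset.mem_range.mp hi)]
    rw [mul_apply_eq_comp, stdProj_apply e n x, map_sum]
    exact Finset.sum_congr rfl fun i hi => by rw [map_smul, h i hi]
  · rw [isSelfAdjoint_iff, stdProj, star_sum]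
    exact Finset.sum_congr rfl fun i _ => by
      rw [ContinuousLinearMap.star_eq_adjoint, elem, InnerProductSpace.adjoint_rankOne]

theorem tendsto_stdProj (e : HilbertBasis ℕ ℝ H) (x : Space H) :
    Tendsto (fun n => x - stdProj e n x) atTop (𝓝 0) := by
  simp only [stdProj_apply]
  simpa using (hasSum_inner_smul_stdBasis e x).tendsto_sum_nat.const_sub x

theorem norm_sub_stdProj_le (e : HilbertBasis ℕ ℝ H) (n : ℕ) (x : Space H) :
    ‖x - stdProj e n x‖ ≤ ‖x‖ := by
  have h := (1 - stdProj e n).le_of_opNorm_le (isStarProjection_stdProj e n).one_sub.norm_le x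
  simpa using h

/-- A Hilbert–Schmidt operator is the limit of its square truncations. -/
theorem IsHS.tendsto_truncation (hA : IsHS e A) :
    Tendsto (fun n => hsNorm e (A - stdProj e n * A * stdProj e n)) atTop (𝓝 0) := by
  have hval (n i : ℕ) : (A - stdProj e n * A * stdProj e n) (stdBasis e i) =
      if i < n then A (stdBasis e i) - stdProj e n (A (stdBasis e i)) else A (stdBasis e i) := by
    by_cases h : i < n <;> simp [stdProj_stdBasis, h]
  refine tendsto_hsNorm_zero hA (fun n i => ?_) fun i => ?_
  · rw [hval]
    split_ifs
    exacts [norm_sub_stdProj_le e n _, le_rfl]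
  · refine (tendsto_stdProj e (A (stdBasis e i))).congr' ?_
    filter_upwards [eventually_gt_atTop i] with n hn
    rw [hval, if_pos hn]

theorem isHS_truncation (e : HilbertBasis ℕ ℝ H) (A : Op H) (n : ℕ) :
    IsHS e (stdProj e n * A * stdProj e n) :=
  (isHS_sum _ fun _ _ => isHS_rankOne e _ _).mul_left _

/-- Hilbert–Schmidt operators are compact, as limits of finite-rank operators. -/
theorem IsHS.isCompactOperator (hA : IsHS e A) : IsCompactOperator A := by
  have hlim : Tendsto (fun n => stdProj e n * A * stdProj e n) atTop (𝓝 A) := by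
    rw [tendsto_iff_norm_sub_tendsto_zero]
    refine squeeze_zero (fun _ => norm_nonneg _) (fun n => ?_) hA.tendsto_truncation
    rw [norm_sub_rev]
    exact (hA.sub (isHS_truncation e A n)).norm_le_hsNorm
  refine isCompactOperator_of_tendsto hlim (Eventually.of_forall fun n => ?_)
  rw [truncation_eq_sum]
  exact Submodule.sum_mem (compactOperator (RingHom.id ℝ) (Space H) (Space H)) fun i _ =>
    Submodule.sum_mem _ fun j _ => Submodule.smul_mem _ _ (isCompactOperator_rankOne _ _)

/-- A limit criterion: `A` lies in the Hilbert–Schmidt closure of `S` as soon as its square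
truncations lie in `S`. -/
theorem IsHS.mem_hsClosure {S : Set (Op H)} (hA : IsHS e A)
    (h : ∀ n, stdProj e n * A * stdProj e n ∈ S) : A ∈ hsClosure e S := by
  refine ⟨hA, fun ε hε => ?_⟩
  obtain ⟨n, hn⟩ := (hA.tendsto_truncation.eventually (gt_mem_nhds hε)).exists
  exact ⟨_, h n, isHS_truncation e A n, hn⟩

end HilbertSchmidt

/-! ### The Lie algebra of the Lorentz form -/

section LieAlgebra

section

variable {E : Type*} [NormedAddCommGroup E] [InnerProductSpace ℝ E] [CompleteSpace E]

theorem inner_star_left (A : E →L[ℝ] E) (x y : E) : inner ℝ (star A x) y = inner ℝ x (A y) := by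
  rw [ContinuousLinearMap.star_eq_adjoint, ContinuousLinearMap.adjoint_inner_left]

theorem inner_star_right (A : E →L[ℝ] E) (x y : E) : inner ℝ x (star A y) = inner ℝ (A x) y := by
  rw [ContinuousLinearMap.star_eq_adjoint, ContinuousLinearMap.adjoint_inner_right]

end

section

variable {H : Type*} [NormedAddCommGroup H] [InnerProductSpace ℝ H]

theorem elem_mul_elem (e : HilbertBasis ℕ ℝ H) (i j k l : ℕ) :
    elem e i j * elem e k l = if j = k then elem e i l else 0 := by
  ext x
  have h := orthonormal_iff_ite.mp (orthonormal_stdBasis e) j k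
  split_ifs with hjk <;> simp [elem, h, hjk, norm_stdBasis]

/-- The operator `diag (-1, 1, 1, …)` representing the Lorentz form. -/
noncomputable def lorentzForm (e : HilbertBasis ℕ ℝ H) : Op H := 1 - (2 : ℝ) • elem e 0 0

theorem lorentzForm_apply (e : HilbertBasis ℕ ℝ H) (x : Space H) :
    lorentzForm e x = x - (2 * inner ℝ (stdBasis e 0) x) • stdBasis e 0 := by
  simp [lorentzForm, elem, smul_smul]

theorem lorentzForm_apply_zero (e : HilbertBasis ℕ ℝ H) :
    lorentzForm e (stdBasis e 0) = -stdBasis e 0 := by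
  rw [lorentzForm_apply, real_inner_self_eq_norm_sq, norm_stdBasis]
  module

theorem isHS_of_mem_gSpace {e : HilbertBasis ℕ ℝ H} {X : Op H} (hX : X ∈ gSpace e) : IsHS e X := by
  obtain ⟨Y, hY, Z, hZ, rfl⟩ := hX
  exact hY.1.add hZ.1

end

variable {H : Type*} [NormedAddCommGroup H] [InnerProductSpace ℝ H] [CompleteSpace H]
  {e : HilbertBasis ℕ ℝ H} {A B X : Op H}

theorem star_rankOne (x y : Space H) :
    star (InnerProductSpace.rankOne ℝ x y : Op H) = InnerProductSpace.rankOne ℝ y x := by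
  rw [ContinuousLinearMap.star_eq_adjoint, InnerProductSpace.adjoint_rankOne]

theorem star_elem (e : HilbertBasis ℕ ℝ H) (i j : ℕ) : star (elem e i j) = elem e j i :=
  star_rankOne _ _

/-- A condition that is linear and closed for the operator norm passes from a generating set to the
closed span for the Hilbert–Schmidt norm. -/
theorem lorentz_skew_of_mem_hsClosure_span {S : Set (Op H)}
    (hS : ∀ X ∈ S, X * lorentzForm e + lorentzForm e * star X = 0)
    (hX : X ∈ hsClosure e (Submodule.span ℝ S)) :
    X * lorentzForm e + lorentzForm e * star X = 0 := by
  have hspan (Y : Op H) (hY : Y ∈ Submodule.span ℝ S) :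
      Y * lorentzForm e + lorentzForm e * star Y = 0 := by
    induction hY using Submodule.span_induction with
    | mem Y hY => exact hS Y hY
    | zero => simp
    | add Y Z _ _ hY hZ =>
      rw [star_add, add_mul, mul_add, add_add_add_comm, hY, hZ, add_zero]
    | smul c Y _ hY =>
      rw [star_smul, star_trivial, smul_mul_assoc, mul_smul_comm, ← smul_add, hY, smul_zero]
  have hclosed : IsClosed {Y : Op H | Y * lorentzForm e + lorentzForm e * star Y = 0} :=
    isClosed_eq (by fun_prop) continuous_const
  refine hclosed.closure_subset_iff.mpr hspan (Metric.mem_closure_iff.mpr fun ε hε => ?_)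
  obtain ⟨Y, hYS, hY, hlt⟩ := hX.2 ε hε
  exact ⟨Y, hYS, by
    rw [dist_eq_norm]
    exact (hX.1.sub hY).norm_le_hsNorm.trans_lt hlt⟩

/-- The elements of `𝔤` are infinitesimal isometries of the Lorentz form. -/
theorem lorentz_skew_of_mem_gSpace (hX : X ∈ gSpace e) :
    X * lorentzForm e + lorentzForm e * star X = 0 := by
  obtain ⟨Y, hY, Z, hZ, rfl⟩ := hX
  have hY' : Y * lorentzForm e + lorentzForm e * star Y = 0 := by
    refine lorentz_skew_of_mem_hsClosure_span ?_ hY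
    rintro _ ⟨i, hi, rfl⟩
    simp only [lorentzForm, star_add, star_elem, sub_mul, mul_sub, add_mul, mul_add, one_mul,
      mul_one, smul_mul_assoc, mul_smul_comm, elem_mul_elem, hi.ne, hi.ne', if_true, if_false]
    module
  have hZ' : Z * lorentzForm e + lorentzForm e * star Z = 0 := by
    refine lorentz_skew_of_mem_hsClosure_span ?_ hZ
    rintro _ ⟨i, j, hi, hij, rfl⟩
    have hj : 0 < j := hi.trans hij
    simp only [lorentzForm, star_sub, star_elem, sub_mul, mul_sub, one_mul,
      mul_one, smul_mul_assoc, mul_smul_comm, elem_mul_elem, hi.ne, hi.ne', hj.ne, hj.ne', if_false]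
    module
  rw [star_add, add_mul, mul_add, add_add_add_comm, hY', hZ', add_zero]

/-- The square truncations of an operator whose matrix satisfies `A_{ij} = c A_{ji}` are
combinations of the operators `e_{ij} + c e_{ji}`. -/
theorem truncation_mem_of_symm {c : ℝ} {S : Submodule ℝ (Op H)} (hc : star A = c • A)
    (hS : ∀ i j, inner ℝ (stdBasis e i) (A (stdBasis e j)) • (elem e i j + c • elem e j i) ∈ S)
    (n : ℕ) : stdProj e n * A * stdProj e n ∈ S := by
  have hsymm (i j : ℕ) : inner ℝ (stdBasis e i) (A (stdBasis e j)) =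
      c * inner ℝ (stdBasis e j) (A (stdBasis e i)) := by
    rw [← inner_star_left, hc, smul_apply, real_inner_smul_left, real_inner_comm]
  have h2 : (2 : ℝ) • (stdProj e n * A * stdProj e n) = ∑ i ∈ Finset.range n,
      ∑ j ∈ Finset.range n,
        inner ℝ (stdBasis e i) (A (stdBasis e j)) • (elem e i j + c • elem e j i) := by
    rw [two_smul, truncation_eq_sum]
    nth_rw 2 [Finset.sum_comm]
    simp only [← Finset.sum_add_distrib]
    refine Finset.sum_congr rfl fun i _ => Finset.sum_congr rfl fun j _ => ?_
    rw [hsymm j i, smul_add, smul_smul, mul_comm c]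
  have h : stdProj e n * A * stdProj e n =
      (1 / 2 : ℝ) • (2 : ℝ) • (stdProj e n * A * stdProj e n) := by
    rw [smul_smul]; norm_num
  rw [h, h2]
  exact S.smul_mem _ (S.sum_mem fun i _ => S.sum_mem fun j _ => hS i j)

/-- `𝔰` contains every skew-adjoint Hilbert–Schmidt operator vanishing at `e_0`. -/
theorem mem_sSpace (hB : IsHS e B) (hskew : star B = -B) (hz : B (stdBasis e 0) = 0) :
    B ∈ sSpace e := by
  refine hB.mem_hsClosure (truncation_mem_of_symm (c := -1) (by simpa using hskew) fun i j => ?_)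
  rw [neg_one_smul, ← sub_eq_add_neg]
  have hz' (j : ℕ) : inner ℝ (stdBasis e 0) (B (stdBasis e j)) = 0 := by
    rw [← inner_star_left, hskew, neg_apply, hz, neg_zero, inner_zero_left]
  rcases Nat.eq_zero_or_pos i with rfl | hi
  · rw [hz', zero_smul]
    exact zero_mem _
  rcases Nat.eq_zero_or_pos j with rfl | hj
  · rw [hz, inner_zero_right, zero_smul]
    exact zero_mem _
  refine Submodule.smul_mem _ _ ?_
  rcases lt_trichotomy i j with h | rfl | h
  · exact Submodule.subset_span ⟨i, j, hi, h, rfl⟩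
  · rw [sub_self]
    exact zero_mem _
  · rw [← neg_sub]
    exact neg_mem (Submodule.subset_span ⟨j, i, hj, h, rfl⟩)

/-- `𝔥` contains the operators `e_0 ⊗ u + u ⊗ e_0` with `u` orthogonal to `e_0`. -/
theorem boost_mem_hSpace {u : Space H} (hu : inner ℝ (stdBasis e 0) u = 0) :
    InnerProductSpace.rankOne ℝ (stdBasis e 0) u + InnerProductSpace.rankOne ℝ u (stdBasis e 0) ∈
      hSpace e := by
  refine ((isHS_rankOne e _ _).add (isHS_rankOne e _ _)).mem_hsClosure
    (truncation_mem_of_symm (c := 1) (by simp [star_rankOne, add_comm]) fun i j => ?_)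
  rw [one_smul]
  have h := orthonormal_iff_ite.mp (orthonormal_stdBasis e)
  rcases Nat.eq_zero_or_pos i with rfl | hi <;> rcases Nat.eq_zero_or_pos j with rfl | hj
  · have hu' : inner ℝ u (stdBasis e 0) = 0 := by rw [real_inner_comm, hu]
    simp [hu, hu', inner_smul_right]
  · exact Submodule.smul_mem _ _ (Submodule.subset_span ⟨j, hj, rfl⟩)
  · rw [add_comm (elem e i 0)]
    exact Submodule.smul_mem _ _ (Submodule.subset_span ⟨i, hi, rfl⟩)
  · simp [inner_smul_right, h, hi.ne', hj.ne]

end LieAlgebra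

/-! ### The sign of large compressions -/

section Compression

variable {E : Type*} [NormedAddCommGroup E] [InnerProductSpace ℝ E]

/-- The compression of an operator to a finite-dimensional subspace. -/
noncomputable def compression (V : Submodule ℝ E) [FiniteDimensional ℝ V] (T : E →L[ℝ] E) :
    V →L[ℝ] V :=
  V.orthogonalProjectionOnto ∘L T ∘L V.subtypeL

theorem coe_compression_apply (V : Submodule ℝ E) [FiniteDimensional ℝ V] (T : E →L[ℝ] E) (x : V) :
    (compression V T x : E) = V.starProjection (T x) := rfl

/-- The determinants of the compressions of `T` and `T'` to all sufficiently large
finite-dimensional subspaces are nonzero and of the same sign. On invertible operators of the form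
`1 + compact` this is the relation of lying in the same connected component. -/
def SameSign (T T' : E →L[ℝ] E) : Prop :=
  ∃ V₀ : Submodule ℝ E, FiniteDimensional ℝ V₀ ∧
    ∀ (V : Submodule ℝ E) [FiniteDimensional ℝ V], V₀ ≤ V →
      0 < (compression V T).det * (compression V T').det

theorem SameSign.symm {T T' : E →L[ℝ] E} (h : SameSign T T') : SameSign T' T := by
  obtain ⟨V₀, h₀, h⟩ := h
  exact ⟨V₀, h₀, fun V _ hV => by rw [mul_comm]; exact h V hV⟩

theorem SameSign.trans {T T' T'' : E →L[ℝ] E} (h : SameSign T T') (h' : SameSign T' T'') :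
    SameSign T T'' := by
  obtain ⟨V₀, h₀, h⟩ := h
  obtain ⟨V₁, h₁, h'⟩ := h'
  refine ⟨V₀ ⊔ V₁, inferInstance, fun V _ hV => ?_⟩
  have a := h V (le_sup_left.trans hV)
  have b := h' V (le_sup_right.trans hV)
  have hne : (compression V T').det ≠ 0 := right_ne_zero_of_mul a.ne'
  have hprod : 0 < (compression V T').det ^ 2 *
      ((compression V T).det * (compression V T'').det) := by
    calc (0 : ℝ) < _ := mul_pos a b
      _ = _ := by ring
  exact pos_of_mul_pos_right hprod (sq_nonneg _)

/-- A compact operator is close to its product with the projection on any large enough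
finite-dimensional subspace. -/
theorem exists_finiteDimensional_approx {K : E →L[ℝ] E} (hK : IsCompactOperator K) {ε : ℝ}
    (hε : 0 < ε) : ∃ V₀ : Submodule ℝ E, FiniteDimensional ℝ V₀ ∧
      ∀ (V : Submodule ℝ E) [FiniteDimensional ℝ V], V₀ ≤ V →
        ∀ x, ‖K x - V.starProjection (K x)‖ ≤ ε * ‖x‖ := by
  obtain ⟨C, hC, hKC⟩ := hK.image_closedBall_subset_compact (f := (K : E →ₗ[ℝ] E)) 1
  obtain ⟨t, -, ht, hCt⟩ := hC.finite_cover_balls hε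
  refine ⟨Submodule.span ℝ t, FiniteDimensional.span_of_finite ℝ ht, fun V _ hV x => ?_⟩
  have key (y : E) (hy : ‖y‖ ≤ 1) : ‖K y - V.starProjection (K y)‖ ≤ ε := by
    obtain ⟨c, hc, hyc⟩ := Set.mem_iUnion₂.mp
      (hCt (hKC ⟨y, by simpa using hy, rfl⟩ : K y ∈ C))
    have hcV : c ∈ V := hV (Submodule.subset_span hc)
    rw [V.starProjection_minimal]
    refine (ciInf_le ⟨0, by rintro _ ⟨z, rfl⟩; positivity⟩ (⟨c, hcV⟩ : V)).trans ?_
    simpa [dist_eq_norm] using (Metric.mem_ball.mp hyc).le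
  rcases eq_or_ne x 0 with rfl | hx
  · simp
  have hx' : 0 < ‖x‖ := norm_pos_iff.mpr hx
  have h := key (‖x‖⁻¹ • x) (by rw [norm_smul, norm_inv, norm_norm, inv_mul_cancel₀ hx'.ne'])
  rw [map_smul, map_smul, ← smul_sub, norm_smul, norm_inv, norm_norm, inv_mul_le_iff₀ hx'] at h
  rwa [mul_comm]

/-- Uniform version of `exists_finiteDimensional_approx` along a compact family. -/
theorem exists_finiteDimensional_approx_of_isCompact {S : Set ℝ} (hS : IsCompact S)
    {K : ℝ → E →L[ℝ] E} (hcont : ContinuousOn K S) (hK : ∀ s ∈ S, IsCompactOperator (K s)) {ε : ℝ}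
    (hε : 0 < ε) : ∃ V₀ : Submodule ℝ E, FiniteDimensional ℝ V₀ ∧
      ∀ (V : Submodule ℝ E) [FiniteDimensional ℝ V], V₀ ≤ V →
        ∀ s ∈ S, ∀ x, ‖K s x - V.starProjection (K s x)‖ ≤ ε * ‖x‖ := by
  refine hS.induction_on (p := fun S => ∃ V₀ : Submodule ℝ E, FiniteDimensional ℝ V₀ ∧
      ∀ (V : Submodule ℝ E) [FiniteDimensional ℝ V], V₀ ≤ V →
        ∀ s ∈ S, ∀ x, ‖K s x - V.starProjection (K s x)‖ ≤ ε * ‖x‖) ?_ ?_ ?_ ?_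
  · exact ⟨⊥, inferInstance, by simp⟩
  · rintro s t hst ⟨V₀, h₀, h⟩
    exact ⟨V₀, h₀, fun V _ hV r hr => h V hV r (hst hr)⟩
  · rintro s t ⟨V₀, h₀, h⟩ ⟨V₁, h₁, h'⟩
    refine ⟨V₀ ⊔ V₁, inferInstance, fun V _ hV r hr => ?_⟩
    rcases hr with hr | hr
    exacts [h V (le_sup_left.trans hV) r hr, h' V (le_sup_right.trans hV) r hr]
  · intro s hs
    obtain ⟨V₀, h₀, h⟩ := exists_finiteDimensional_approx (hK s hs) (half_pos hε)
    refine ⟨{r | ‖K r - K s‖ < ε / 2}, ?_, V₀, h₀, fun V _ hV r hr x => ?_⟩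
    · have := (tendsto_iff_norm_sub_tendsto_zero.mp (hcont s hs))
      exact this.eventually (gt_mem_nhds (half_pos hε))
    · have h1 : ‖(K r - K s) x - V.starProjection ((K r - K s) x)‖ ≤ ε / 2 * ‖x‖ := by
        have := Vᗮ.norm_starProjection_apply_le ((K r - K s) x)
        rw [V.starProjection_orthogonal_val] at this
        exact this.trans ((K r - K s).le_of_opNorm_le (le_of_lt hr) x)
      have h2 := h V hV x
      calc ‖K r x - V.starProjection (K r x)‖
          = ‖((K r - K s) x - V.starProjection ((K r - K s) x)) +
              (K s x - V.starProjection (K s x))‖ := by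
            congr 1
            simp only [sub_apply, map_sub]
            abel
        _ ≤ ε / 2 * ‖x‖ + ε / 2 * ‖x‖ := (norm_add_le _ _).trans (add_le_add h1 h2)
        _ = ε * ‖x‖ := by ring

/-- The operator that is minus the identity on `F` and the identity on its orthogonal complement
has compressions of determinant `(-1) ^ dim F` to all subspaces containing `F`. -/
theorem even_finrank_of_sameSign {F : Submodule ℝ E} [FiniteDimensional ℝ F]
    (h : SameSign (1 - (2 : ℝ) • F.starProjection) 1) : Even (Module.finrank ℝ F) := by
  obtain ⟨V₀, h₀, h⟩ := h
  have h := h (V₀ ⊔ F) le_sup_left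
  set V := V₀ ⊔ F
  have hFV : F ≤ V := le_sup_right
  have hone : compression V (1 : E →L[ℝ] E) = 1 := by
    ext x
    rw [coe_compression_apply]
    exact V.starProjection_mem_subspace_eq_self x
  let F' : Submodule ℝ V := F.comap V.subtype
  have hF' : Module.finrank ℝ F' = Module.finrank ℝ F :=
    (Submodule.comapSubtypeEquivOfLe hFV).finrank_eq
  have hrefl : (compression V (1 - (2 : ℝ) • F.starProjection) : V →ₗ[ℝ] V) =
      (F'ᗮ.reflection.toLinearEquiv : V →ₗ[ℝ] V) := by
    ext x
    have hproj : (F'.starProjection x : E) = F.starProjection x := by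
      refine Submodule.eq_starProjection_of_mem_of_inner_eq_zero ?_ ?_ |>.symm
      · exact F'.starProjection_apply_mem x
      · intro w hw
        have := F'.starProjection_inner_eq_zero x ⟨w, hFV hw⟩ hw
        simpa using this
    have hmem : V.starProjection (F.starProjection x) = F.starProjection x :=
      Submodule.starProjection_eq_self_iff.mpr (hFV (F.starProjection_apply_mem _))
    have hx : V.starProjection (x : E) = x := V.starProjection_mem_subspace_eq_self x
    simp [coe_compression_apply, Submodule.reflection_apply, map_sub, hx, hmem, hproj, two_smul]
    abel
  have hdet : (compression V (1 - (2 : ℝ) • F.starProjection)).det =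
      (-1) ^ Module.finrank ℝ F := by
    rw [ContinuousLinearMap.det, hrefl]
    have := Submodule.det_reflection F'ᗮ
    rw [Submodule.orthogonal_orthogonal, hF'] at this
    exact this
  rw [hone, hdet, ContinuousLinearMap.det] at h
  by_contra hodd
  rw [Nat.not_even_iff_odd] at hodd
  simp [hodd.neg_one_pow] at h
  exact absurd h (by norm_num)

variable [CompleteSpace E]

/-- A continuous family of invertible operators is uniformly bounded below on a compact set. -/
theorem exists_pos_le_norm_of_isUnit {S : Set ℝ} (hS : IsCompact S) {g : ℝ → E →L[ℝ] E}
    (hcont : ContinuousOn g S) (hg : ∀ s ∈ S, IsUnit (g s)) :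
    ∃ c > 0, ∀ s ∈ S, ∀ x, c * ‖x‖ ≤ ‖g s x‖ := by
  have hinv : ContinuousOn (fun s => Ring.inverse (g s)) S := fun s hs => by
    obtain ⟨u, hu⟩ := hg s hs
    have h := NormedRing.inverse_continuousAt u
    rw [hu] at h
    exact ContinuousAt.comp_continuousWithinAt (f := g) h (hcont s hs)
  obtain ⟨M, hM⟩ := hS.exists_bound_of_continuousOn hinv
  refine ⟨(max M 1)⁻¹, by positivity, fun s hs x => ?_⟩
  rw [inv_mul_le_iff₀ (by positivity)]
  have hx : x = Ring.inverse (g s) (g s x) := by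
    rw [← mul_apply_eq_comp, Ring.inverse_mul_cancel _ (hg s hs), one_apply_eq_self]
  calc ‖x‖ = ‖Ring.inverse (g s) (g s x)‖ := congrArg _ hx
    _ ≤ max M 1 * ‖g s x‖ :=
      ContinuousLinearMap.le_of_opNorm_le _ ((hM s hs).trans (le_max_left _ _)) _

/-- The sign of large compressions is constant along a continuous path of invertible operators of
the form `1 + compact`: by compactness one subspace `V₀` makes all compressions along the path to
subspaces `V ≥ V₀` injective, so that their determinant does not vanish. -/
theorem sameSign_of_path {a b : ℝ} (hab : a ≤ b) {g : ℝ → E →L[ℝ] E}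
    (hcont : ContinuousOn g (Set.Icc a b)) (hg : ∀ s ∈ Set.Icc a b, IsUnit (g s))
    (hK : ∀ s ∈ Set.Icc a b, IsCompactOperator (g s - 1 : E →L[ℝ] E)) : SameSign (g a) (g b) := by
  obtain ⟨c, hc, hlow⟩ := exists_pos_le_norm_of_isUnit isCompact_Icc hcont hg
  obtain ⟨V₀, h₀, hV₀⟩ := exists_finiteDimensional_approx_of_isCompact isCompact_Icc
    (K := fun s => g s - 1) (hcont.sub continuousOn_const) hK (half_pos hc)
  refine ⟨V₀, h₀, fun V _ hV => ?_⟩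
  have hne (s : ℝ) (hs : s ∈ Set.Icc a b) : (compression V (g s)).det ≠ 0 := by
    have hker : LinearMap.ker (compression V (g s) : V →ₗ[ℝ] V) = ⊥ := by
      rw [LinearMap.ker_eq_bot']
      intro x hx
      have hx0 : V.starProjection (g s x) = 0 := by
        rw [← coe_compression_apply]
        exact congrArg Subtype.val hx
      have h := hV₀ V hV s hs x
      have hxV : V.starProjection (x : E) = x := V.starProjection_mem_subspace_eq_self x
      have h1 : (g s - 1) x - V.starProjection ((g s - 1) x) = g s x := by
        simp [map_sub, hx0, hxV]
      rw [h1] at h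
      have h2 := hlow s hs x
      have h3 : ‖(x : E)‖ ≤ 0 := by nlinarith
      exact Subtype.ext (norm_le_zero_iff.mp h3)
    exact (LinearMap.isUnit_det _ ((LinearMap.isUnit_iff_ker_eq_bot _).mpr hker)).ne_zero
  have hdet : ContinuousOn (fun s => (compression V (g s)).det) (Set.Icc a b) := by
    refine ContinuousLinearMap.continuous_det.comp_continuousOn ?_
    exact (continuousOn_const.clm_comp (hcont.clm_comp continuousOn_const))
  by_contra hneg
  have ha := hne a (Set.left_mem_Icc.mpr hab)
  have hb := hne b (Set.right_mem_Icc.mpr hab)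
  have hlt : (compression V (g a)).det * (compression V (g b)).det < 0 :=
    lt_of_le_of_ne (not_lt.mp hneg) (mul_ne_zero ha hb)
  have h0 : (0 : ℝ) ∈ (fun s => (compression V (g s)).det) '' Set.Icc a b := by
    refine (isPreconnected_Icc.image _ hdet).ordConnected.uIcc_subset
      ⟨a, Set.left_mem_Icc.mpr hab, rfl⟩ ⟨b, Set.right_mem_Icc.mpr hab, rfl⟩ ?_
    rw [Set.mem_uIcc]
    rcases mul_neg_iff.mp hlt with h | h
    exacts [Or.inr ⟨h.2.le, h.1.le⟩, Or.inl ⟨h.1.le, h.2.le⟩]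
  obtain ⟨s, hs, hs0⟩ := h0
  exact hne s hs hs0

end Compression

/-! ### Admissible paths -/

section Paths

variable {H : Type*} [NormedAddCommGroup H] [InnerProductSpace ℝ H]

/-- The squared Hilbert–Schmidt norm is bounded along a continuous path on a compact interval. -/
theorem HSContinuousOn.exists_bound {e : HilbertBasis ℕ ℝ H} {ω : ℝ → Op H} {a b : ℝ}
    (hω : HSContinuousOn e ω (Set.Icc a b)) (hHS : ∀ s ∈ Set.Icc a b, IsHS e (ω s)) :
    ∃ C, ∀ s ∈ Set.Icc a b, ∑' i, ‖ω s (stdBasis e i)‖ ^ 2 ≤ C := by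
  refine (isCompact_Icc (a := a) (b := b)).induction_on
    (p := fun S => ∃ C, ∀ s ∈ S, ∑' i, ‖ω s (stdBasis e i)‖ ^ 2 ≤ C) ?_ ?_ ?_ ?_
  · exact ⟨0, by simp⟩
  · rintro s t hst ⟨C, h⟩
    exact ⟨C, fun r hr => h r (hst hr)⟩
  · rintro s t ⟨C, h⟩ ⟨C', h'⟩
    refine ⟨max C C', fun r hr => ?_⟩
    rcases hr with hr | hr
    exacts [(h r hr).trans (le_max_left _ _), (h' r hr).trans (le_max_right _ _)]
  · intro s hs
    obtain ⟨δ, hδ, h⟩ := hω s hs 1 one_pos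
    set N := ∑' i, ‖ω s (stdBasis e i)‖ ^ 2 with hN
    refine ⟨Set.Icc a b ∩ {r | |r - s| < δ}, ?_, 2 * (1 + N), ?_⟩
    · refine inter_mem self_mem_nhdsWithin (mem_nhdsWithin_of_mem_nhds ?_)
      simpa [Metric.ball, Real.dist_eq] using Metric.ball_mem_nhds s hδ
    · rintro r ⟨hr, hrs⟩
      obtain ⟨hd, hlt⟩ := h r hr hrs
      have hd1 : ∑' i, ‖(ω r - ω s) (stdBasis e i)‖ ^ 2 ≤ 1 := by
        rw [hsNorm, Real.sqrt_lt' one_pos] at hlt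
        simpa using hlt.le
      calc ∑' i, ‖ω r (stdBasis e i)‖ ^ 2
          ≤ ∑' i, 2 * (‖(ω r - ω s) (stdBasis e i)‖ ^ 2 + ‖ω s (stdBasis e i)‖ ^ 2) := by
            refine (hHS r hr).tsum_le_tsum (fun i => ?_) ((Summable.add hd (hHS s hs)).mul_left 2)
            have h1 : ω r (stdBasis e i) = (ω r - ω s) (stdBasis e i) + ω s (stdBasis e i) := by
              simp
            rw [h1]
            exact (pow_le_pow_left₀ (norm_nonneg _) (norm_add_le _ _) 2).trans add_sq_le
        _ = 2 * (∑' i, ‖(ω r - ω s) (stdBasis e i)‖ ^ 2 + N) := by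
            rw [tsum_mul_left, Summable.tsum_add hd (hHS s hs)]
        _ ≤ 2 * (1 + N) := by gcongr

/-- The endpoints of a path with `γ⁻¹ γ̇` bounded in Hilbert–Schmidt norm differ by a
Hilbert–Schmidt operator. The mean value inequality is applied to the scalar function
`s ↦ ∑_{i < N} ⟪y i, γ s (e i)⟫` with `y i = (γ b - γ a) (e i)`, uniformly in `N`. -/
theorem isHS_sub_of_path {e : HilbertBasis ℕ ℝ H} {γ ω : ℝ → Op H} {a b C : ℝ} (hab : a ≤ b)
    (hHS : ∀ s ∈ Set.Icc a b, IsHS e (ω s))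
    (hC : ∀ s ∈ Set.Icc a b, ∑' i, ‖ω s (stdBasis e i)‖ ^ 2 ≤ C)
    (hγ : ∀ s ∈ Set.Icc a b, HasDerivWithinAt γ (γ s * ω s) (Set.Icc a b) s) :
    IsHS e (γ b - γ a) := by
  have hcont : ContinuousOn γ (Set.Icc a b) := fun s hs => (hγ s hs).continuousWithinAt
  obtain ⟨M, hM⟩ := isCompact_Icc.exists_bound_of_continuousOn hcont
  have hM0 : 0 ≤ M := (norm_nonneg _).trans (hM a (Set.left_mem_Icc.mpr hab))
  set y : ℕ → Space H := fun i => (γ b - γ a) (stdBasis e i) with hy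
  refine summable_of_sum_le (c := (M * √C * (b - a)) ^ 2) (fun i => by positivity) fun s => ?_
  set Y := ∑ i ∈ s, ‖y i‖ ^ 2 with hY
  have hY0 : 0 ≤ Y := Finset.sum_nonneg fun i _ => by positivity
  have hderiv (t : ℝ) (ht : t ∈ Set.Icc a b) :
      HasDerivWithinAt (fun t => ∑ i ∈ s, inner ℝ (y i) (γ t (stdBasis e i)))
        (∑ i ∈ s, inner ℝ (y i) ((γ t * ω t) (stdBasis e i))) (Set.Icc a b) t := by
    refine HasDerivWithinAt.fun_sum fun i _ => ?_
    have h1 := (hγ t ht).clm_apply (hasDerivWithinAt_const t (Set.Icc a b) (stdBasis e i))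
    simpa using (hasDerivWithinAt_const t (Set.Icc a b) (y i)).inner ℝ h1
  have hbound (t : ℝ) (ht : t ∈ Set.Icc a b) :
      ‖∑ i ∈ s, inner ℝ (y i) ((γ t * ω t) (stdBasis e i))‖ ≤ √Y * (M * √C) := by
    calc ‖∑ i ∈ s, inner ℝ (y i) ((γ t * ω t) (stdBasis e i))‖
        ≤ ∑ i ∈ s, ‖y i‖ * (M * ‖ω t (stdBasis e i)‖) := by
          refine (norm_sum_le _ _).trans (Finset.sum_le_sum fun i _ => ?_)
          refine (norm_inner_le_norm _ _).trans (mul_le_mul_of_nonneg_left ?_ (norm_nonneg _))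
          exact (γ t).le_of_opNorm_le (hM t ht) _
      _ = M * ∑ i ∈ s, ‖y i‖ * ‖ω t (stdBasis e i)‖ := by
          rw [Finset.mul_sum]
          exact Finset.sum_congr rfl fun i _ => by ring
      _ ≤ M * (√Y * √(∑ i ∈ s, ‖ω t (stdBasis e i)‖ ^ 2)) := by
          gcongr
          exact Real.sum_mul_le_sqrt_mul_sqrt _ _ _
      _ ≤ M * (√Y * √C) := by
          gcongr
          exact ((hHS t ht).sum_le_tsum s fun i _ => by positivity).trans (hC t ht)
      _ = √Y * (M * √C) := by ring
  have hmvt := Convex.norm_image_sub_le_of_norm_hasDerivWithin_le hderiv hbound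
    (convex_Icc a b) (Set.left_mem_Icc.mpr hab) (Set.right_mem_Icc.mpr hab)
  have hval : (∑ i ∈ s, inner ℝ (y i) (γ b (stdBasis e i))) -
      ∑ i ∈ s, inner ℝ (y i) (γ a (stdBasis e i)) = Y := by
    rw [← Finset.sum_sub_distrib]
    refine Finset.sum_congr rfl fun i _ => ?_
    rw [← inner_sub_right, ← real_inner_self_eq_norm_sq]
    rfl
  rw [hval, Real.norm_of_nonneg hY0, Real.norm_of_nonneg (sub_nonneg.mpr hab)] at hmvt
  have hsq : √Y * √Y = Y := Real.mul_self_sqrt hY0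
  have hle : √Y ≤ M * √C * (b - a) := by
    rcases (Real.sqrt_nonneg Y).eq_or_lt with h0 | h0
    · rw [← h0]
      have := sub_nonneg.mpr hab
      positivity
    · refine le_of_mul_le_mul_left ?_ h0
      linarith
  calc Y = √Y ^ 2 := (Real.sq_sqrt hY0).symm
    _ ≤ _ := pow_le_pow_left₀ (Real.sqrt_nonneg _) hle 2

variable [CompleteSpace H]

/-- The properties of the elements of `SO_HS(H, 1)` that are used: Hilbert–Schmidt perturbations of
the identity which preserve the Lorentz form and the time orientation, and whose large compressions
have positive determinant. -/
structure IsProperLorentz (e : HilbertBasis ℕ ℝ H) (A : Op H) : Prop where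
  isHS : IsHS e (A - 1)
  form : A * lorentzForm e * star A = lorentzForm e
  one_le : 1 ≤ inner ℝ (stdBasis e 0) (A (stdBasis e 0))
  sameSign : SameSign A 1

/-- The first row of a Lorentz transformation is a unit timelike vector. -/
theorem norm_star_apply_sq {e : HilbertBasis ℕ ℝ H} {A : Op H}
    (hA : A * lorentzForm e * star A = lorentzForm e) :
    ‖star A (stdBasis e 0)‖ ^ 2 = 2 * inner ℝ (stdBasis e 0) (A (stdBasis e 0)) ^ 2 - 1 := by
  set y := star A (stdBasis e 0) with hy
  have hz : inner ℝ y (stdBasis e 0) = inner ℝ (stdBasis e 0) (A (stdBasis e 0)) := by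
    rw [hy, inner_star_left]
  have h1 : inner ℝ y (lorentzForm e y) = (-1 : ℝ) := by
    have h2 : inner ℝ y (lorentzForm e y) =
        inner ℝ (stdBasis e 0) ((A * lorentzForm e * star A) (stdBasis e 0)) := by
      rw [hy, inner_star_left]
      rfl
    rw [h2, hA, lorentzForm_apply_zero, inner_neg_right, real_inner_self_eq_norm_sq, norm_stdBasis]
    norm_num
  rw [lorentzForm_apply, inner_sub_right, inner_smul_right, real_inner_self_eq_norm_sq,
    real_inner_comm y, hz] at h1
  linarith

theorem one_le_inner_sq {e : HilbertBasis ℕ ℝ H} {A : Op H}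
    (hA : A * lorentzForm e * star A = lorentzForm e) :
    1 ≤ inner ℝ (stdBasis e 0) (A (stdBasis e 0)) ^ 2 := by
  have h := norm_star_apply_sq hA
  have h1 : inner ℝ (stdBasis e 0) (A (stdBasis e 0)) ^ 2 ≤ ‖star A (stdBasis e 0)‖ ^ 2 := by
    rw [real_inner_comm, ← inner_star_right, ← sq_abs]
    refine pow_le_pow_left₀ (abs_nonneg _) ?_ 2
    simpa [norm_stdBasis] using abs_real_inner_le_norm (stdBasis e 0) (star A (stdBasis e 0))
  linarith

/-- The properties of `IsProperLorentz` propagate backwards along a `C¹` piece of a path. -/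
theorem IsProperLorentz.of_path {e : HilbertBasis ℕ ℝ H} {γ ω : ℝ → Op H} {a b : ℝ} (hab : a ≤ b)
    (hunit : ∀ s ∈ Set.Icc a b, IsUnit (γ s)) (hω : ∀ s ∈ Set.Icc a b, ω s ∈ gSpace e)
    (hωc : HSContinuousOn e ω (Set.Icc a b))
    (hγ : ∀ s ∈ Set.Icc a b, HasDerivWithinAt γ (γ s * ω s) (Set.Icc a b) s)
    (hb : IsProperLorentz e (γ b)) : IsProperLorentz e (γ a) := by
  have hcont : ContinuousOn γ (Set.Icc a b) := fun s hs => (hγ s hs).continuousWithinAt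
  have ha_mem := Set.left_mem_Icc.mpr hab
  have hb_mem := Set.right_mem_Icc.mpr hab
  have hωHS (s) (hs : s ∈ Set.Icc a b) := isHS_of_mem_gSpace (hω s hs)
  obtain ⟨C, hC⟩ := hωc.exists_bound hωHS
  have hHS (s : ℝ) (hs : s ∈ Set.Icc a b) : IsHS e (γ s - 1) := by
    have hsub : Set.Icc s b ⊆ Set.Icc a b := Set.Icc_subset_Icc_left hs.1
    have h := isHS_sub_of_path hs.2 (fun t ht => hωHS t (hsub ht)) (fun t ht => hC t (hsub ht))
      (fun t ht => (hγ t (hsub ht)).mono hsub)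
    have h2 : γ s - 1 = (γ b - 1) - (γ b - γ s) := by abel
    rw [h2]
    exact hb.isHS.sub h
  have hform (s : ℝ) (hs : s ∈ Set.Icc a b) :
      γ s * lorentzForm e * star (γ s) = lorentzForm e := by
    have hd (t : ℝ) (ht : t ∈ Set.Icc a b) :
        HasDerivWithinAt (fun t => γ t * lorentzForm e * star (γ t)) 0 (Set.Icc a b) t := by
      have h := ((hγ t ht).mul_const (lorentzForm e)).mul (hγ t ht).star
      have h0 : γ t * ω t * lorentzForm e * star (γ t) +
          γ t * lorentzForm e * star (γ t * ω t) = 0 := by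
        calc _ = γ t * (ω t * lorentzForm e + lorentzForm e * star (ω t)) * star (γ t) := by
              rw [star_mul]
              noncomm_ring
          _ = 0 := by rw [lorentz_skew_of_mem_gSpace (hω t ht), mul_zero, zero_mul]
      rwa [h0] at h
    have h := (convex_Icc a b).norm_image_sub_le_of_norm_hasDerivWithin_le (C := 0) hd
      (fun t _ => by simp) hs hb_mem
    rw [zero_mul, norm_le_zero_iff, sub_eq_zero] at h
    rw [← h, hb.form]
  refine ⟨hHS a ha_mem, hform a ha_mem, ?_, ?_⟩
  · -- the entry `⟪e_0, γ e_0⟫` cannot cross zero, since its square is at least `1`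
    by_contra hlt
    have hsq (s : ℝ) (hs : s ∈ Set.Icc a b) := one_le_inner_sq (hform s hs)
    have hneg : inner ℝ (stdBasis e 0) (γ a (stdBasis e 0)) ≤ 0 := by
      nlinarith [hsq a ha_mem]
    have hc : ContinuousOn (fun s => inner ℝ (stdBasis e 0) (γ s (stdBasis e 0)) : ℝ → ℝ)
        (Set.Icc a b) :=
      ContinuousOn.inner (𝕜 := ℝ) continuousOn_const (hcont.clm_apply continuousOn_const)
    obtain ⟨s, hs, hs0⟩ := intermediate_value_Icc hab hc ⟨hneg, zero_le_one.trans hb.one_le⟩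
    have := hsq s hs
    simp only at hs0
    rw [hs0] at this
    norm_num at this
  · exact (sameSign_of_path hab hcont hunit fun s hs => (hHS s hs).isCompactOperator).trans
      hb.sameSign

theorem isProperLorentz_one (e : HilbertBasis ℕ ℝ H) : IsProperLorentz e (1 : Op H) := by
  refine ⟨by simp [IsHS], by simp, by simp [norm_stdBasis], ?_⟩
  refine sameSign_of_path (le_refl (0 : ℝ)) (g := fun _ => (1 : Op H)) continuousOn_const
    (fun _ _ => isUnit_one) fun _ _ => ?_
  rw [sub_self]
  exact isCompactOperator_zero

/-- The pieces of an admissible path are traversed backwards, starting from the identity. -/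
theorem isProperLorentz_of_mem_SOHS {e : HilbertBasis ℕ ℝ H} {A : Op H} (hA : A ∈ SOHS e) :
    IsProperLorentz e A := by
  obtain ⟨γ, ⟨hunit, n, τ, hτ0, hτn, hτ, hpiece⟩, rfl, hγ1⟩ :
      ∃ γ : ℝ → Op H, IsAdmissiblePath e γ ∧ γ 0 = A ∧ γ 1 = 1 := by
    by_contra hne
    push Not at hne
    have htop : cmDist e A 1 = ⊤ := by
      simp only [cmDist, iInf_eq_top]
      exact fun γ hγ => absurd hγ.2.2 (hne γ hγ.1 hγ.2.1)
    exact hA.2.ne htop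
  have hmono (i j : ℕ) (hij : i ≤ j) (hj : j ≤ n) : τ i ≤ τ j := by
    induction j, hij using Nat.le_induction with
    | base => exact le_rfl
    | succ j hij ih => exact (ih (by lia)).trans (hτ j (by lia)).le
  -- induction on the number `k` of pieces already traversed
  have key (k : ℕ) (hk : k ≤ n) : IsProperLorentz e (γ (τ (n - k))) := by
    induction k with
    | zero =>
      rw [Nat.sub_zero, hτn, hγ1]
      exact isProperLorentz_one e
    | succ k ih =>
      have hi : n - (k + 1) < n := by lia
      have hs : n - k = n - (k + 1) + 1 := by lia
      have ih := ih (by lia)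
      rw [hs] at ih
      obtain ⟨ω, hω, hωc, hγ⟩ := hpiece _ hi
      refine ih.of_path (hτ _ hi).le (fun s hs => hunit s ⟨?_, ?_⟩) hω hωc hγ
      · exact (hτ0 ▸ hmono 0 _ (Nat.zero_le _) hi.le).trans hs.1
      · exact hs.2.trans (hτn ▸ hmono _ n hi le_rfl)
  have h := key n le_rfl
  rwa [Nat.sub_self, hτ0] at h

end Paths

/-! ### Closed forms of exponentials -/

section Exponential

variable {𝔸 : Type*} [NormedRing 𝔸] [NormedAlgebra ℝ 𝔸] [CompleteSpace 𝔸]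

/-- The exponential is the solution of its differential equation. -/
theorem exp_smul_eq_of_hasDerivAt {B : 𝔸} {F : ℝ → 𝔸} (h0 : F 0 = 1)
    (hF : ∀ t, HasDerivAt F (B * F t) t) (t : ℝ) : NormedSpace.exp (t • B) = F t := by
  let _ : NormedAlgebra ℚ 𝔸 := NormedAlgebra.restrictScalars ℚ ℝ 𝔸
  have hG (s : ℝ) : HasDerivAt (fun s => NormedSpace.exp (s • (-B)) * F s) 0 s := by
    have h := (hasDerivAt_exp_smul_const (𝕂 := ℝ) (-B) s).mul (hF s)
    have h1 : NormedSpace.exp (s • (-B)) * -B * F s +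
        NormedSpace.exp (s • (-B)) * (B * F s) = 0 := by
      noncomm_ring
    rwa [h1] at h
  have hconst := is_const_of_deriv_eq_zero (fun s => (hG s).differentiableAt)
    (fun s => (hG s).deriv) t 0
  simp only [zero_smul, NormedSpace.exp_zero, h0, mul_one] at hconst
  have hinv : NormedSpace.exp (t • B) * NormedSpace.exp (t • (-B)) = 1 := by
    rw [smul_neg, ← NormedSpace.exp_add_of_commute (Commute.refl (t • B)).neg_right,
      add_neg_cancel, NormedSpace.exp_zero]
  calc NormedSpace.exp (t • B)
      = NormedSpace.exp (t • B) * (NormedSpace.exp (t • (-B)) * F t) := by rw [hconst, mul_one]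
    _ = F t := by rw [← mul_assoc, hinv, one_mul]

/-- The exponential of a complex structure on the image of the projection `P` is a rotation. -/
theorem exp_smul_of_mul_self_eq_neg {B P : 𝔸} (hB : B * B = -P) (hBP : B * P = B) (t : ℝ) :
    NormedSpace.exp (t • B) = 1 - P + Real.cos t • P + Real.sin t • B := by
  refine exp_smul_eq_of_hasDerivAt (F := fun t => 1 - P + Real.cos t • P + Real.sin t • B)
    (by simp) (fun s => ?_) t
  have h := (((Real.hasDerivAt_cos s).smul_const P).const_add (1 - P)).add
    ((Real.hasDerivAt_sin s).smul_const B)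
  refine h.congr_deriv ?_
  simp only [mul_add, mul_sub, mul_one, mul_smul_comm, hB, hBP]
  module

/-- The exponential of an involution on the image of the projection `P` is a hyperbolic rotation. -/
theorem exp_smul_of_mul_self_eq {W P : 𝔸} (hW : W * W = P) (hWP : W * P = W) (t : ℝ) :
    NormedSpace.exp (t • W) = 1 - P + Real.cosh t • P + Real.sinh t • W := by
  refine exp_smul_eq_of_hasDerivAt (F := fun t => 1 - P + Real.cosh t • P + Real.sinh t • W)
    (by simp) (fun s => ?_) t
  have h := (((Real.hasDerivAt_cosh s).smul_const P).const_add (1 - P)).add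
    ((Real.hasDerivAt_sinh s).smul_const W)
  refine h.congr_deriv ?_
  simp only [mul_add, mul_sub, mul_one, mul_smul_comm, hW, hWP]
  module

end Exponential

/-! ### Polar decomposition -/

section Polar

variable {H : Type*} [NormedAddCommGroup H] [InnerProductSpace ℝ H]

/-- The generator of the boosts in the direction of `u`. -/
noncomputable def boost (e : HilbertBasis ℕ ℝ H) (u : Space H) : Op H :=
  InnerProductSpace.rankOne ℝ (stdBasis e 0) u + InnerProductSpace.rankOne ℝ u (stdBasis e 0)

/-- The projection on the plane of the boosts in the direction of `u`. -/
noncomputable def boostPlane (e : HilbertBasis ℕ ℝ H) (u : Space H) : Op H :=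
  InnerProductSpace.rankOne ℝ (stdBasis e 0) (stdBasis e 0) + InnerProductSpace.rankOne ℝ u u

variable {e : HilbertBasis ℕ ℝ H} {u : Space H}

theorem boost_apply (e : HilbertBasis ℕ ℝ H) (u x : Space H) :
    boost e u x = inner ℝ u x • stdBasis e 0 + inner ℝ (stdBasis e 0) x • u := by
  simp [boost]

theorem boostPlane_apply (e : HilbertBasis ℕ ℝ H) (u x : Space H) :
    boostPlane e u x = inner ℝ (stdBasis e 0) x • stdBasis e 0 + inner ℝ u x • u := by
  simp [boostPlane]

theorem boost_apply_zero (hzu : inner ℝ (stdBasis e 0) u = 0) :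
    boost e u (stdBasis e 0) = u := by
  have hzu' : inner ℝ u (stdBasis e 0) = 0 := by rw [real_inner_comm, hzu]
  simp [boost_apply, hzu', norm_stdBasis]

theorem boost_apply_self (hu : ‖u‖ = 1) (hzu : inner ℝ (stdBasis e 0) u = 0) :
    boost e u u = stdBasis e 0 := by
  simp [boost_apply, hzu, hu]

theorem boost_mul_self (hu : ‖u‖ = 1) (hzu : inner ℝ (stdBasis e 0) u = 0) :
    boost e u * boost e u = boostPlane e u := by
  ext x
  rw [mul_apply_eq_comp, boost_apply e u x, map_add, map_smul, map_smul, boost_apply_zero hzu,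
    boost_apply_self hu hzu, boostPlane_apply, add_comm]

theorem boost_mul_boostPlane (hu : ‖u‖ = 1) (hzu : inner ℝ (stdBasis e 0) u = 0) :
    boost e u * boostPlane e u = boost e u := by
  ext x
  rw [mul_apply_eq_comp, boostPlane_apply e u x, map_add, map_smul, map_smul, boost_apply_zero hzu,
    boost_apply_self hu hzu, boost_apply, add_comm]

theorem lorentzForm_mul_boost (hzu : inner ℝ (stdBasis e 0) u = 0) :
    lorentzForm e * boost e u = -boost e u * lorentzForm e := by
  have hzu' : inner ℝ u (stdBasis e 0) = 0 := by rw [real_inner_comm, hzu]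
  have hJu : lorentzForm e u = u := by rw [lorentzForm_apply, hzu]; simp
  ext x
  simp only [mul_apply_eq_comp, neg_mul, neg_apply, boost_apply e u x, map_add, map_smul, hJu,
    lorentzForm_apply_zero, lorentzForm_apply e x, map_sub, boost_apply_zero hzu]
  module

variable [CompleteSpace H] {A : Op H}

theorem star_boost (e : HilbertBasis ℕ ℝ H) (u : Space H) : star (boost e u) = boost e u := by
  simp [boost, star_rankOne, add_comm]

theorem isHS_boost (e : HilbertBasis ℕ ℝ H) (u : Space H) : IsHS e (boost e u) :=
  (isHS_rankOne e _ _).add (isHS_rankOne e _ _)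

theorem isHS_exp_boost_sub_one (hu : ‖u‖ = 1) (hzu : inner ℝ (stdBasis e 0) u = 0) (t : ℝ) :
    IsHS e (NormedSpace.exp (t • boost e u) - 1) := by
  have h : NormedSpace.exp (t • boost e u) - 1 =
      (Real.cosh t - 1) • boostPlane e u + Real.sinh t • boost e u := by
    rw [exp_smul_of_mul_self_eq (boost_mul_self hu hzu) (boost_mul_boostPlane hu hzu)]
    module
  rw [h]
  refine IsHS.add (IsHS.smul _ ?_) ((isHS_boost e u).smul _)
  exact (isHS_rankOne e _ _).add (isHS_rankOne e _ _)

theorem exp_boost_apply_zero (hu : ‖u‖ = 1) (hzu : inner ℝ (stdBasis e 0) u = 0) (t : ℝ) :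
    NormedSpace.exp (t • boost e u) (stdBasis e 0) =
      Real.cosh t • stdBasis e 0 + Real.sinh t • u := by
  have hzu' : inner ℝ u (stdBasis e 0) = 0 := by rw [real_inner_comm, hzu]
  rw [exp_smul_of_mul_self_eq (boost_mul_self hu hzu) (boost_mul_boostPlane hu hzu)]
  simp [boostPlane_apply, boost_apply_zero hzu, hzu', norm_stdBasis]

/-- The first row of a Lorentz transformation preserving the time orientation is that of a boost. -/
theorem exists_boost_eq (h1 : A * lorentzForm e * star A = lorentzForm e)
    (h2 : 1 ≤ inner ℝ (stdBasis e 0) (A (stdBasis e 0))) :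
    ∃ (r : ℝ) (u : Space H), ‖u‖ = 1 ∧ inner ℝ (stdBasis e 0) u = 0 ∧
      star A (stdBasis e 0) = Real.cosh r • stdBasis e 0 + Real.sinh r • u := by
  have hnorm := norm_star_apply_sq h1
  set a : ℝ := inner ℝ (stdBasis e 0) (A (stdBasis e 0)) with ha
  set y := star A (stdBasis e 0) with hy
  have hzy : inner ℝ (stdBasis e 0) y = a := by
    rw [hy, inner_star_right, real_inner_comm]
  set b := y - a • stdBasis e 0 with hb
  have hzb : inner ℝ (stdBasis e 0) b = 0 := by
    rw [hb, inner_sub_right, inner_smul_right, hzy, real_inner_self_eq_norm_sq, norm_stdBasis]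
    ring
  have hbnorm : ‖b‖ ^ 2 = a ^ 2 - 1 := by
    have h : ‖b‖ ^ 2 = ‖y‖ ^ 2 - a ^ 2 := by
      rw [hb, norm_sub_sq_real, inner_smul_right, real_inner_comm, hzy, norm_smul, norm_stdBasis,
        mul_one, Real.norm_eq_abs, sq_abs]
      ring
    rw [h, hnorm]
    ring
  obtain ⟨u, hu, hzu, hbu⟩ : ∃ u : Space H, ‖u‖ = 1 ∧ inner ℝ (stdBasis e 0) u = 0 ∧
      b = ‖b‖ • u := by
    rcases eq_or_ne b 0 with h0 | h0
    · exact ⟨stdBasis e 1, norm_stdBasis e 1, (orthonormal_stdBasis e).2 zero_ne_one,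
        by rw [h0, norm_zero, zero_smul]⟩
    · have hb0 : ‖b‖ ≠ 0 := norm_ne_zero_iff.mpr h0
      refine ⟨‖b‖⁻¹ • b, ?_, ?_, ?_⟩
      · rw [norm_smul, norm_inv, norm_norm, inv_mul_cancel₀ hb0]
      · rw [inner_smul_right, hzb, mul_zero]
      · rw [smul_smul, mul_inv_cancel₀ hb0, one_smul]
  refine ⟨Real.arsinh ‖b‖, u, hu, hzu, ?_⟩
  have hcosh : Real.cosh (Real.arsinh ‖b‖) = a := by
    have h := Real.cosh_sq (Real.arsinh ‖b‖)
    rw [Real.sinh_arsinh, hbnorm, sub_add_cancel] at h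
    exact (pow_left_inj₀ (Real.cosh_pos _).le (zero_le_one.trans h2) two_ne_zero).mp h
  rw [Real.sinh_arsinh, hcosh, ← hbu, hb]
  abel

/-- Rotations: the orthogonal operators fixing `e_0` which are Hilbert–Schmidt perturbations of the
identity and whose large compressions have positive determinant. -/
structure IsRotation (e : HilbertBasis ℕ ℝ H) (R : Op H) : Prop where
  star_mul_self : star R * R = 1
  mul_star_self : R * star R = 1
  apply_zero : R (stdBasis e 0) = stdBasis e 0
  isHS : IsHS e (R - 1)
  sameSign : SameSign R 1

/-- Polar decomposition: a proper Lorentz transformation is the product of a rotation and a boost.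
The boost is the one with the same first row, and `t ↦ A * Exp (-t U)` joins `A` to its rotation
part. -/
theorem IsProperLorentz.exists_polar (hA : IsProperLorentz e A) (hunit : IsUnit A) :
    ∃ (R U : Op H), IsRotation e R ∧ U ∈ hSpace e ∧ A = R * NormedSpace.exp U := by
  let _ : NormedAlgebra ℚ (Op H) := NormedAlgebra.restrictScalars ℚ ℝ (Op H)
  obtain ⟨r, u, hu, hzu, hrow⟩ := exists_boost_eq hA.form hA.one_le
  set W := boost e u with hW
  have hinv (t : ℝ) : NormedSpace.exp ((-t) • W) * NormedSpace.exp (t • W) = 1 := by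
    rw [neg_smul, ← NormedSpace.exp_add_of_commute (Commute.refl (t • W)).neg_left,
      neg_add_cancel, NormedSpace.exp_zero]
  set Y := NormedSpace.exp ((-r) • W) with hY
  have hYstar : star Y = Y := by
    rw [hY, NormedSpace.star_exp, star_smul, star_boost, star_trivial]
  have hYunit : IsUnit Y := NormedSpace.isUnit_exp _
  have hYform : Y * lorentzForm e * Y = lorentzForm e := by
    have hs : SemiconjBy (lorentzForm e) ((-r) • W) (r • W) := by
      rw [SemiconjBy, mul_smul_comm, lorentzForm_mul_boost hzu, smul_mul_assoc, neg_mul, smul_neg,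
        neg_smul, neg_neg]
    have := hs.exp_neg_mul_mul_exp_eq_self
    rwa [← neg_smul] at this
  set R := A * Y with hR
  have hRform : R * lorentzForm e * star R = lorentzForm e := by
    calc R * lorentzForm e * star R = A * (Y * lorentzForm e * Y) * star A := by
          rw [hR, star_mul, hYstar]
          noncomm_ring
      _ = lorentzForm e := by rw [hYform, hA.form]
  have hstarRz : star R (stdBasis e 0) = stdBasis e 0 := by
    rw [hR, star_mul, hYstar, mul_apply_eq_comp, hrow, ← exp_boost_apply_zero hu hzu,
      ← mul_apply_eq_comp, hinv, one_apply_eq_self]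
  have hRz : R (stdBasis e 0) = stdBasis e 0 := by
    have h : (R * lorentzForm e * star R) (stdBasis e 0) = -R (stdBasis e 0) := by
      rw [mul_apply_eq_comp, mul_apply_eq_comp, hstarRz, lorentzForm_apply_zero, map_neg]
    rw [hRform, lorentzForm_apply_zero] at h
    exact (neg_injective h).symm
  have hRR : R * star R = 1 := by
    have h1 : R * elem e 0 0 * star R = elem e 0 0 := by
      ext x
      simp only [mul_apply_eq_comp, elem, InnerProductSpace.rankOne_apply, map_smul, hRz,
        inner_star_right]
    have h2 : R * star R = R * lorentzForm e * star R + (2 : ℝ) • (R * elem e 0 0 * star R) := by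
      rw [lorentzForm, mul_sub, sub_mul, mul_one, mul_smul_comm, smul_mul_assoc]
      abel
    rw [h2, hRform, h1, lorentzForm]
    abel
  have hRunit : IsUnit R := hunit.mul hYunit
  have hpath (t : ℝ) : IsHS e (A * NormedSpace.exp ((-t) • W) - 1) := by
    have h : A * NormedSpace.exp ((-t) • W) - 1 =
        (A - 1) + A * (NormedSpace.exp ((-t) • W) - 1) := by noncomm_ring
    rw [h]
    exact hA.isHS.add ((isHS_exp_boost_sub_one hu hzu _).mul_left A)
  have hsign : SameSign A R := by
    have h := sameSign_of_path zero_le_one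
      (g := fun t : ℝ => A * NormedSpace.exp ((-(t * r)) • W))
      (by
        have : Continuous fun t : ℝ => A * NormedSpace.exp ((-(t * r)) • W) :=
          continuous_const.mul (NormedSpace.exp_continuous.comp (by fun_prop))
        exact this.continuousOn)
      (fun t _ => hunit.mul (NormedSpace.isUnit_exp _))
      (fun t _ => (hpath (t * r)).isCompactOperator)
    simpa [hR, hY] using h
  refine ⟨R, r • W, ⟨?_, hRR, hRz, hpath r, hsign.symm.trans hA.sameSign⟩, ?_, ?_⟩
  · obtain ⟨v, hv⟩ := hRunit
    rw [← hv] at hRR ⊢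
    rw [← v.inv_mul_cancel_left (star (v : Op H)), hRR, mul_one, Units.inv_mul]
  · have h := boost_mem_hSpace (e := e) (u := r • u) (by rw [inner_smul_right, hzu, mul_zero])
    have h2 : r • W = InnerProductSpace.rankOne ℝ (stdBasis e 0) (r • u) +
        InnerProductSpace.rankOne ℝ (r • u) (stdBasis e 0) := by
      simp [hW, boost]
    rwa [h2]
  · rw [hR, mul_assoc, hinv, mul_one]

end Polar

/-! ### Complex structures on even-dimensional subspaces -/

section ComplexStructure

variable {E : Type*} [NormedAddCommGroup E] [InnerProductSpace ℝ E] [CompleteSpace E]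

/-- An even-dimensional subspace carries an orthogonal complex structure: it rotates each of the
planes spanned by the pairs of vectors of an orthonormal basis. -/
theorem exists_complexStructure {V : Submodule ℝ E} [FiniteDimensional ℝ V]
    (hV : Even (Module.finrank ℝ V)) :
    ∃ B : E →L[ℝ] E, star B = -B ∧ B * B = -V.starProjection ∧ B * V.starProjection = B := by
  obtain ⟨m, hm⟩ := hV
  let b : OrthonormalBasis (Fin m ⊕ Fin m) ℝ V :=
    (stdOrthonormalBasis ℝ V).reindex ((finCongr hm).trans finSumFinEquiv.symm)
  let rot : V →ₗ[ℝ] V :=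
    b.toBasis.constr ℝ (Sum.elim (fun k => b (Sum.inr k)) (fun k => -b (Sum.inl k)))
  have hinl (k : Fin m) : rot (b (Sum.inl k)) = b (Sum.inr k) := by
    rw [← b.coe_toBasis, Module.Basis.constr_basis]
    rfl
  have hinr (k : Fin m) : rot (b (Sum.inr k)) = -b (Sum.inl k) := by
    rw [← b.coe_toBasis, Module.Basis.constr_basis]
    rfl
  have hrot : rot ∘ₗ rot = -LinearMap.id := by
    refine b.toBasis.ext fun i => ?_
    rcases i with k | k <;> simp [hinl, hinr]
  -- skew-adjointness is checked on the orthonormal basis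
  have hskew : rot = (-rot).adjoint := by
    rw [LinearMap.eq_adjoint_iff_basis b.toBasis b.toBasis]
    have h := orthonormal_iff_ite.mp b.orthonormal
    rintro (k | k) (l | l) <;> simp [hinl, hinr, h]
  have hskew' (x y : V) : inner ℝ (rot x) y = -inner ℝ x (rot y) := by
    rw [(LinearMap.eq_adjoint_iff _ _).mp hskew x y, LinearMap.neg_apply, inner_neg_right]
  let B : E →L[ℝ] E :=
    V.subtypeL ∘L LinearMap.toContinuousLinearMap rot ∘L V.orthogonalProjectionOnto
  have hB (x : E) : B x = rot (V.orthogonalProjectionOnto x) := rfl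
  refine ⟨B, ?_, ?_, ?_⟩
  · rw [ContinuousLinearMap.star_eq_adjoint, eq_comm, ContinuousLinearMap.eq_adjoint_iff]
    intro x y
    rw [neg_apply, inner_neg_left, hB, hB,
      ← Submodule.inner_orthogonalProjectionOnto_eq_of_mem_left,
      ← Submodule.inner_orthogonalProjectionOnto_eq_of_mem_right, hskew', neg_neg]
  · ext x
    have h := LinearMap.congr_fun hrot (V.orthogonalProjectionOnto x)
    simp only [LinearMap.comp_apply, LinearMap.neg_apply, LinearMap.id_apply] at h
    rw [mul_apply_eq_comp, hB, hB x, Submodule.orthogonalProjectionOnto_mem_subspace_eq_self, h]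
    rfl
  · ext x
    have h : V.orthogonalProjectionOnto (V.starProjection x) = V.orthogonalProjectionOnto x :=
      Submodule.orthogonalProjectionOnto_mem_subspace_eq_self _
    rw [mul_apply_eq_comp, hB, hB x, h]

end ComplexStructure

/-! ### Eigenspaces of compact self-adjoint operators -/

section Enumeration

/-- A set of positive reals accumulating at most at `0` can be listed in decreasing order. -/
theorem exists_strictAntiOn_enumeration {M : Set ℝ} (hM : ∀ μ ∈ M, 0 < μ)
    (hfin : ∀ ε > 0, (M ∩ Set.Ici ε).Finite) :
    ∃ (J : Set ℕ) (g : ℕ → ℝ), Set.BijOn g J M ∧ StrictAntiOn g J := by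
  -- the position of `μ` in the list is the number of larger elements
  let f : ℝ → ℕ := fun μ => (M ∩ Set.Ioi μ).ncard
  have hf (μ ν : ℝ) (hμ : μ ∈ M) (hν : ν ∈ M) (hlt : μ < ν) : f ν < f μ := by
    refine Set.ncard_lt_ncard ⟨fun x hx => ⟨hx.1, hlt.trans hx.2⟩, fun h => ?_⟩
      ((hfin μ (hM μ hμ)).subset fun x hx => ⟨hx.1, Set.mem_Ici.mpr (le_of_lt hx.2)⟩)
    exact lt_irrefl ν (h ⟨hν, hlt⟩).2
  have hinj : Set.InjOn f M := fun μ hμ ν hν h => by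
    rcases lt_trichotomy μ ν with hlt | heq | hlt
    · exact absurd h (hf μ ν hμ hν hlt).ne'
    · exact heq
    · exact absurd h (hf ν μ hν hμ hlt).ne
  have hinv : Set.InvOn (Function.invFunOn f M) f M (f '' M) :=
    hinj.bijOn_image.invOn_invFunOn
  have hmaps : Set.MapsTo (Function.invFunOn f M) (f '' M) M :=
    fun j hj => Function.invFunOn_mem hj
  refine ⟨f '' M, Function.invFunOn f M,
    hinv.symm.bijOn hmaps (Set.mapsTo_image f M), fun j hj k hk hjk => ?_⟩
  by_contra hle
  rcases (not_lt.mp hle).lt_or_eq with h | h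
  · have := hf _ _ (hmaps hj) (hmaps hk) h
    rw [hinv.2 hj, hinv.2 hk] at this
    lia
  · have := congrArg f h
    rw [hinv.2 hj, hinv.2 hk] at this
    lia

end Enumeration

section Spectral

variable {E : Type*} [NormedAddCommGroup E] [InnerProductSpace ℝ E] [CompleteSpace E]

open Module.End

theorem hasOrthogonalProjection_eigenspace (T : E →L[ℝ] E) (μ : ℝ) :
    (eigenspace (T : E →ₗ[ℝ] E) μ).HasOrthogonalProjection := by
  have h : IsClosed (eigenspace (T : E →ₗ[ℝ] E) μ : Set E) := by
    have h1 : (eigenspace (T : E →ₗ[ℝ] E) μ : Set E) = {x | T x = μ • x} := by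
      ext x
      simp
    rw [h1]
    exact isClosed_eq T.continuous (by fun_prop)
  have := h.completeSpace_coe
  infer_instance

attribute [instance] hasOrthogonalProjection_eigenspace

/-- The orthogonal projection on an eigenspace. -/
noncomputable def eigenProj (T : E →L[ℝ] E) (μ : ℝ) : E →L[ℝ] E :=
  (eigenspace (T : E →ₗ[ℝ] E) μ).starProjection

theorem isStarProjection_eigenProj (T : E →L[ℝ] E) (μ : ℝ) : IsStarProjection (eigenProj T μ) :=
  isStarProjection_starProjection

theorem apply_eigenProj (T : E →L[ℝ] E) (μ : ℝ) (x : E) :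
    T (eigenProj T μ x) = μ • eigenProj T μ x :=
  mem_eigenspace_iff.mp (Submodule.starProjection_apply_mem _ x)

theorem eigenProj_apply_of_eq {T : E →L[ℝ] E} {μ : ℝ} {x : E} (h : T x = μ • x) :
    eigenProj T μ x = x :=
  Submodule.starProjection_eq_self_iff.mpr (mem_eigenspace_iff.mpr h)

theorem eigenProj_commute {T A : E →L[ℝ] E} (h : Commute A T) (h' : Commute (star A) T) (μ : ℝ) :
    Commute A (eigenProj T μ) := by
  have hmaps {A : E →L[ℝ] E} (h : Commute A T) {w : E} (hw : T w = μ • w) : T (A w) = μ • A w := by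
    rw [← mul_apply_eq_comp, ← h.eq, mul_apply_eq_comp, hw, map_smul]
  ext x
  rw [mul_apply_eq_comp, mul_apply_eq_comp]
  refine (Submodule.eq_starProjection_of_mem_of_inner_eq_zero ?_ fun w hw => ?_).symm
  · exact mem_eigenspace_iff.mpr (hmaps h (apply_eigenProj T μ x))
  · rw [← map_sub, ← inner_star_right]
    exact Submodule.starProjection_inner_eq_zero _ _
      (mem_eigenspace_iff.mpr (hmaps h' (mem_eigenspace_iff.mp hw)))

theorem eigenProj_mul_eigenProj {T : E →L[ℝ] E} (hT : IsSelfAdjoint T) {μ ν : ℝ} (h : μ ≠ ν) :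
    eigenProj T μ * eigenProj T ν = 0 := by
  ext x
  have hν := apply_eigenProj T ν x
  set y := eigenProj T ν x with hy
  rw [mul_apply_eq_comp, ← hy, zero_apply]
  refine (Submodule.starProjection_apply_eq_zero_iff _).mpr fun w hw => ?_
  have hw : T w = μ • w := mem_eigenspace_iff.mp hw
  have h1 : μ * inner ℝ w y = ν * inner ℝ w y := by
    rw [← real_inner_smul_left, ← hw, ← inner_smul_right, ← hν]
    nth_rw 1 [← hT.star_eq]
    exact inner_star_left T w y
  have h2 : (μ - ν) * inner ℝ w y = 0 := by linarith
  exact (mul_eq_zero.mp h2).resolve_left (sub_ne_zero.mpr h)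

/-- The eigenvalues of a compact self-adjoint operator accumulate at most at `0`. -/
theorem finite_eigenvalues {T : E →L[ℝ] E} (hT : IsSelfAdjoint T) (hc : IsCompactOperator T)
    {ε : ℝ} (hε : 0 < ε) : ({μ | HasEigenvalue (T : E →ₗ[ℝ] E) μ} ∩ Set.Ici ε).Finite := by
  -- images of orthonormal eigenvectors would be at mutual distances at least `ε`
  by_contra hinf
  let f := Set.Infinite.natEmbedding _ hinf
  have hv (n : ℕ) : ∃ v : E, ‖v‖ = 1 ∧ T v = (f n : ℝ) • v := by
    obtain ⟨v, hv⟩ := (f n).2.1.exists_hasEigenvector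
    have hv0 : ‖v‖ ≠ 0 := norm_ne_zero_iff.mpr hv.2
    refine ⟨‖v‖⁻¹ • v, by rw [norm_smul, norm_inv, norm_norm, inv_mul_cancel₀ hv0], ?_⟩
    have h : T v = (f n : ℝ) • v := hv.apply_eq_smul
    rw [map_smul, h, smul_comm]
  choose v hv1 hv using hv
  obtain ⟨C, hC, hTC⟩ := hc.image_closedBall_subset_compact (f := (T : E →ₗ[ℝ] E)) 1
  obtain ⟨y, -, φ, hφ, hlim⟩ := hC.tendsto_subseq (x := fun n => T (v n))
    fun n => hTC ⟨v n, by simp [hv1], rfl⟩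
  obtain ⟨N, hN⟩ := Metric.cauchySeq_iff'.mp hlim.cauchySeq ε hε
  have hlt := hN (N + 1) (Nat.le_succ N)
  set a := φ (N + 1)
  set b := φ N
  have hab : (f a : ℝ) ≠ f b := fun h =>
    (hφ (Nat.lt_succ_self N)).ne' (f.injective (Subtype.ext h))
  have horth : inner ℝ (v a) (v b) = (0 : ℝ) := by
    have h := eigenProj_mul_eigenProj hT hab
    have h1 : inner ℝ (v a) (v b) =
        inner ℝ (v a) ((eigenProj T (f a) * eigenProj T (f b)) (v b)) := by
      rw [mul_apply_eq_comp, eigenProj_apply_of_eq (hv b),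
        ← (isStarProjection_eigenProj T (f a)).isSelfAdjoint.star_eq, inner_star_right,
        eigenProj_apply_of_eq (hv a)]
    rw [h1, h, zero_apply, inner_zero_right]
  have ha : ε ≤ f a := (f a).2.2
  have hdist : ε ^ 2 ≤ ‖T (v a) - T (v b)‖ ^ 2 := by
    rw [hv, hv, norm_sub_sq_real, real_inner_smul_left, inner_smul_right, horth, norm_smul, hv1,
      norm_smul, hv1]
    simp only [Real.norm_eq_abs, mul_one, mul_zero, sub_zero, sq_abs]
    nlinarith [sq_nonneg (f b : ℝ)]
  have hlt' : ‖T (v a) - T (v b)‖ < ε := by simpa [dist_eq_norm] using hlt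
  exact absurd (pow_lt_pow_left₀ hlt' (norm_nonneg _) two_ne_zero) (not_lt.mpr hdist)

/-- Strong convergence to `0` of a bounded sequence of operators may be tested on the eigenvectors
of a compact self-adjoint operator. -/
theorem tendsto_zero_of_tendsto_on_eigenvectors {T : E →L[ℝ] E} (hT : IsSelfAdjoint T)
    (hc : IsCompactOperator T) {A : ℕ → E →L[ℝ] E} {C : ℝ} (hA : ∀ n, ‖A n‖ ≤ C)
    (h : ∀ (μ : ℝ) (x : E), T x = μ • x → Tendsto (fun n => A n x) atTop (𝓝 0)) (x : E) :
    Tendsto (fun n => A n x) atTop (𝓝 0) := by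
  let D : Submodule ℝ E :=
    { carrier := {x | Tendsto (fun n => A n x) atTop (𝓝 0)}
      add_mem' := fun {x y} hx hy => by
        simpa using Tendsto.add (show Tendsto (fun n => A n x) atTop (𝓝 0) from hx) hy
      zero_mem' := by simp
      smul_mem' := fun c x hx => by
        simpa using Tendsto.const_smul (show Tendsto (fun n => A n x) atTop (𝓝 0) from hx) c }
  have hD : (⨆ μ, eigenspace (T : E →ₗ[ℝ] E) μ) ≤ D :=
    iSup_le fun μ x hx => h μ x (mem_eigenspace_iff.mp hx)
  have hdense : x ∈ closure ((⨆ μ, eigenspace (T : E →ₗ[ℝ] E) μ : Submodule ℝ E) : Set E) := by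
    have h1 := T.orthogonalComplement_iSup_eigenspaces_eq_bot hc hT.isSymmetric
    rw [← Submodule.topologicalClosure_eq_top_iff] at h1
    rw [← Submodule.topologicalClosure_coe, h1]
    trivial
  rw [Metric.tendsto_atTop]
  intro ε hε
  have hC : 0 ≤ C := (norm_nonneg _).trans (hA 0)
  obtain ⟨y, hy, hxy⟩ := Metric.mem_closure_iff.mp hdense (ε / (2 * (C + 1))) (by positivity)
  obtain ⟨N, hN⟩ := Metric.tendsto_atTop.mp (show Tendsto (fun n => A n y) atTop (𝓝 0) from hD hy)
    (ε / 2) (half_pos hε)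
  refine ⟨N, fun n hn => ?_⟩
  have h1 := hN n hn
  rw [dist_zero_right] at h1 ⊢
  rw [dist_eq_norm] at hxy
  calc ‖A n x‖ = ‖A n (x - y) + A n y‖ := by rw [map_sub, sub_add_cancel]
    _ ≤ C * ‖x - y‖ + ‖A n y‖ :=
      (norm_add_le _ _).trans (add_le_add ((A n).le_of_opNorm_le (hA n) _) le_rfl)
    _ < (C + 1) * (ε / (2 * (C + 1))) + ε / 2 :=
      add_lt_add_of_le_of_lt
        (mul_le_mul (by linarith) hxy.le (norm_nonneg _) (by linarith)) h1
    _ = ε := by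
      field_simp
      norm_num

end Spectral

/-! ### Orthogonal compact perturbations of the identity -/

section Orthogonal

variable {E : Type*} [NormedAddCommGroup E] [InnerProductSpace ℝ E] [CompleteSpace E]

open Module.End

/-- The positive operator `(R - 1)* (R - 1)`; for orthogonal `R` a plane rotated by the angle `θ`
is an eigenspace for the eigenvalue `2 - 2 cos θ`. -/
noncomputable def gap (R : E →L[ℝ] E) : E →L[ℝ] E := star (R - 1) * (R - 1)

variable {R : E →L[ℝ] E}

theorem gap_eq (hR : star R * R = 1) : gap R = (2 : ℝ) • (1 : E →L[ℝ] E) - (R + star R) := by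
  rw [gap, star_sub, star_one, sub_mul, mul_sub, hR, mul_one, one_mul, two_smul]
  abel

theorem isSelfAdjoint_gap (R : E →L[ℝ] E) : IsSelfAdjoint (gap R) :=
  IsSelfAdjoint.star_mul_self _

theorem isCompactOperator_gap (hc : IsCompactOperator (R - 1 : E →L[ℝ] E)) :
    IsCompactOperator (gap R) :=
  hc.clm_comp (star (R - 1) : E →L[ℝ] E)

theorem commute_gap (hR : star R * R = 1) (hR' : R * star R = 1) : Commute R (gap R) := by
  rw [gap_eq hR, Commute, SemiconjBy]
  simp only [mul_sub, sub_mul, mul_add, add_mul, hR, hR', mul_smul_comm, smul_mul_assoc, mul_one,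
    one_mul]

theorem star_commute_gap (hR : star R * R = 1) (hR' : R * star R = 1) :
    Commute (star R) (gap R) := by
  rw [gap_eq hR, Commute, SemiconjBy]
  simp only [mul_sub, sub_mul, mul_add, add_mul, hR, hR', mul_smul_comm, smul_mul_assoc, mul_one,
    one_mul]

theorem norm_apply_of_star_mul_self (hR : star R * R = 1) (x : E) : ‖R x‖ = ‖x‖ := by
  have h : ‖R x‖ ^ 2 = ‖x‖ ^ 2 := by
    rw [← real_inner_self_eq_norm_sq, ← inner_star_left, ← mul_apply_eq_comp, hR,
      one_apply_eq_self, real_inner_self_eq_norm_sq]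
  exact (pow_left_inj₀ (norm_nonneg _) (norm_nonneg _) two_ne_zero).mp h

theorem eigenvalue_gap_mem (hR : star R * R = 1) {μ : ℝ}
    (hμ : HasEigenvalue (gap R : E →ₗ[ℝ] E) μ) : 0 ≤ μ ∧ μ ≤ 4 := by
  obtain ⟨v, hv⟩ := hμ.exists_hasEigenvector
  have hv0 : 0 < ‖v‖ := norm_pos_iff.mpr hv.2
  have h1 : gap R v = μ • v := hv.apply_eq_smul
  have h2 : ‖(R - 1) v‖ ^ 2 = μ * ‖v‖ ^ 2 := by
    have h3 : inner ℝ (gap R v) v = ‖(R - 1) v‖ ^ 2 := by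
      rw [gap, mul_apply_eq_comp, inner_star_left, real_inner_self_eq_norm_sq]
    rw [← h3, h1, real_inner_smul_left, real_inner_self_eq_norm_sq]
  have h4 : ‖(R - 1) v‖ ≤ 2 * ‖v‖ := by
    calc ‖(R - 1) v‖ = ‖R v - v‖ := rfl
      _ ≤ ‖R v‖ + ‖v‖ := norm_sub_le _ _
      _ = 2 * ‖v‖ := by rw [norm_apply_of_star_mul_self hR]; ring
  have h5 : ‖(R - 1) v‖ ^ 2 ≤ (2 * ‖v‖) ^ 2 := pow_le_pow_left₀ (norm_nonneg _) h4 2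
  constructor
  · by_contra h
    nlinarith [sq_nonneg ‖(R - 1) v‖, pow_pos hv0 2]
  · by_contra h
    nlinarith [pow_pos hv0 2]

theorem commute_eigenProj_gap (hR : star R * R = 1) (hR' : R * star R = 1) (μ : ℝ) :
    Commute R (eigenProj (gap R) μ) :=
  eigenProj_commute (commute_gap hR hR') (star_commute_gap hR hR') μ

theorem star_commute_eigenProj_gap (hR : star R * R = 1) (hR' : R * star R = 1) (μ : ℝ) :
    Commute (star R) (eigenProj (gap R) μ) :=
  eigenProj_commute (star_commute_gap hR hR') (by rw [star_star]; exact commute_gap hR hR') μ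

theorem add_star_mul_eigenProj (hR : star R * R = 1) (μ : ℝ) :
    (R + star R) * eigenProj (gap R) μ = (2 - μ) • eigenProj (gap R) μ := by
  have h : gap R * eigenProj (gap R) μ = μ • eigenProj (gap R) μ := by
    ext x
    exact apply_eigenProj (gap R) μ x
  have h2 : R + star R = (2 : ℝ) • (1 : E →L[ℝ] E) - gap R := by rw [gap_eq hR]; abel
  rw [h2, sub_mul, h, smul_mul_assoc, one_mul, sub_smul]

/-- On the eigenspace of `gap R` for the largest possible eigenvalue `4`, `R` is minus the
identity. -/
theorem apply_eq_neg_of_gap_eq (hR : star R * R = 1) {x : E} (hx : gap R x = (4 : ℝ) • x) :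
    R x = -x := by
  have h1 : (R + star R) x = (-2 : ℝ) • x := by
    have h2 : R + star R = (2 : ℝ) • (1 : E →L[ℝ] E) - gap R := by rw [gap_eq hR]; abel
    rw [h2, sub_apply, smul_apply, one_apply_eq_self, hx]
    module
  have h2 : inner ℝ x (R x) = -‖x‖ ^ 2 := by
    have h3 : inner ℝ x ((R + star R) x) = 2 * inner ℝ x (R x) := by
      rw [add_apply, inner_add_right, inner_star_right, real_inner_comm x (R x)]
      ring
    rw [h1, inner_smul_right, real_inner_self_eq_norm_sq] at h3
    linarith
  have h4 : ‖R x + x‖ ^ 2 = 0 := by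
    rw [norm_add_sq_real, norm_apply_of_star_mul_self hR, real_inner_comm, h2]
    ring
  exact eq_neg_of_add_eq_zero_left (norm_eq_zero.mp (pow_eq_zero_iff two_ne_zero |>.mp h4))

theorem gap_apply_of_apply_eq_neg (hR : star R * R = 1) {x : E} (hx : R x = -x) :
    gap R x = (4 : ℝ) • x := by
  have h : star R x = -x := by
    have h1 : star R (R x) = x := by rw [← mul_apply_eq_comp, hR, one_apply_eq_self]
    rw [hx, map_neg] at h1
    rw [← neg_eq_iff_eq_neg.mpr h1.symm]
  rw [gap_eq hR, sub_apply, add_apply, hx, h, smul_apply, one_apply_eq_self]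
  module

/-- The `-1`-eigenspace of an orthogonal compact perturbation of the identity with positive large
compressions is even-dimensional: with `P` the projection on it, `t ↦ R + t (1 - R) (1 - P)` joins
`R` to `1 - 2 P` through invertible operators. -/
theorem even_finrank_eigenspace_gap (hR : star R * R = 1) (hR' : R * star R = 1)
    (hc : IsCompactOperator (R - 1 : E →L[ℝ] E)) (hsign : SameSign R 1) :
    Even (Module.finrank ℝ (eigenspace (gap R : E →ₗ[ℝ] E) 4)) := by
  set P := eigenProj (gap R) 4 with hP
  have hcomm : Commute R P := commute_eigenProj_gap hR hR' 4
  have hPP (x : E) : P (P x) = P x := by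
    rw [← mul_apply_eq_comp, (isStarProjection_eigenProj (gap R) 4).isIdempotentElem.eq]
  have hRP (x : E) : R (P x) = -P x := apply_eq_neg_of_gap_eq hR (apply_eigenProj _ _ x)
  let g : ℝ → E →L[ℝ] E := fun t => R + t • ((1 - R) * (1 - P))
  have hgK (t : ℝ) : IsCompactOperator (g t - 1 : E →L[ℝ] E) := by
    have h : g t - 1 = (R - 1) * (1 - t • (1 - P)) := by
      simp only [g, mul_sub, sub_mul, mul_one, one_mul, mul_smul_comm, smul_sub]
      abel
    rw [h]
    exact hc.comp_clm (1 - t • (1 - P))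
  have hgu (t : ℝ) (ht : t ∈ Set.Icc (0 : ℝ) 1) : IsUnit (g t) := by
    rcases (hgK t).hasEigenvalue_or_mem_resolventSet (μ := -1) (by norm_num) with h | h
    · exfalso
      obtain ⟨x, hx⟩ := h.exists_hasEigenvector
      have h0 : g t x = 0 := by
        have h1 : (g t - 1) x = (-1 : ℝ) • x := hx.apply_eq_smul
        rw [sub_apply, one_apply_eq_self, neg_one_smul] at h1
        simpa using h1
      have hgx : g t x = R x + t • ((x - P x) - R (x - P x)) := by
        simp [g, mul_apply_eq_comp]
      have hPR (y : E) : P (R y) = R (P y) := (congrArg (fun T => T y) hcomm.eq).symm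
      have hPx : P x = 0 := by
        have h1 : P (g t x) = -P x := by
          rw [hgx, map_add, map_smul, map_sub P, map_sub P, map_sub R, map_sub P, hPR, hPR, hPP,
            sub_self, sub_self, sub_self, smul_zero, add_zero, hRP]
        rw [h0, map_zero] at h1
        exact neg_eq_zero.mp h1.symm
      rw [hPx, sub_zero, h0] at hgx
      have h2 : (1 - t) • R x = -(t • x) := by
        rw [eq_neg_iff_add_eq_zero, hgx]
        module
      have hx0 : 0 < ‖x‖ := norm_pos_iff.mpr hx.2
      -- `(1 - t) R x = -t x` with `R` isometric forces `t = 1 / 2` and `R x = -x`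
      have ht2 : t = 1 / 2 := by
        have h3 := congrArg norm h2
        rw [norm_neg, norm_smul, norm_smul, norm_apply_of_star_mul_self hR, Real.norm_of_nonneg
          (sub_nonneg.mpr ht.2), Real.norm_of_nonneg ht.1] at h3
        have := mul_right_cancel₀ hx0.ne' h3
        linarith
      have hRx : R x = -x := by
        have h4 : (1 / 2 : ℝ) • R x = (1 / 2 : ℝ) • -x := by
          rw [smul_neg, ← ht2, ← h2, ht2]
          norm_num
        exact smul_right_injective E (by norm_num : (1 / 2 : ℝ) ≠ 0) h4
      have h5 : P x = x := eigenProj_apply_of_eq (gap_apply_of_apply_eq_neg hR hRx)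
      exact hx.2 (by rw [← h5, hPx])
    · rw [spectrum.mem_resolventSet_iff] at h
      have h1 : algebraMap ℝ (E →L[ℝ] E) (-1) - (g t - 1) = -g t := by
        rw [map_neg, map_one]
        abel
      rw [h1] at h
      exact (IsUnit.neg_iff _).mp h
  have hpath := sameSign_of_path zero_le_one
    (by
      have : Continuous g := by fun_prop
      exact this.continuousOn) hgu (fun t _ => hgK t)
  have hg0 : g 0 = R := by simp [g]
  have hg1 : g 1 = 1 - (2 : ℝ) • P := by
    have h : R * P = -P := by
      ext x
      exact hRP x
    simp only [g, mul_sub, sub_mul, mul_one, one_mul, h, one_smul]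
    module
  rw [hg0, hg1] at hpath
  have := (gap R).finite_dimensional_eigenspace (isCompactOperator_gap hc) 4 four_ne_zero
  exact even_finrank_of_sameSign (hpath.symm.trans hsign)

/-- On each eigenspace of `gap R`, `R` is the rotation by an angle `θ` for some complex structure
`B`. For `θ < π` this is `B = (R - R*) / (2 sin θ)`; for `θ = π` any complex structure will do. -/
theorem exists_rotation_generator (hR : star R * R = 1) (hR' : R * star R = 1)
    (hc : IsCompactOperator (R - 1 : E →L[ℝ] E)) (hsign : SameSign R 1) {μ : ℝ} (hμ0 : 0 < μ)
    (hμ4 : μ ≤ 4) :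
    ∃ B : E →L[ℝ] E, star B = -B ∧ B * B = -eigenProj (gap R) μ ∧ B * eigenProj (gap R) μ = B ∧
      NormedSpace.exp (Real.arccos (1 - μ / 2) • B) = 1 + (R - 1) * eigenProj (gap R) μ := by
  set P := eigenProj (gap R) μ with hP
  set θ := Real.arccos (1 - μ / 2) with hθ
  have hcos : Real.cos θ = 1 - μ / 2 := Real.cos_arccos (by linarith) (by linarith)
  have hsuff (B : E →L[ℝ] E) (hBB : B * B = -P) (hBP : B * P = B)
      (hRP : R * P = Real.cos θ • P + Real.sin θ • B) :
      NormedSpace.exp (θ • B) = 1 + (R - 1) * P := by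
    rw [exp_smul_of_mul_self_eq_neg hBB hBP, sub_mul, hRP, one_mul]
    abel
  have hPP : P * P = P := (isStarProjection_eigenProj (gap R) μ).isIdempotentElem.eq
  have hPstar : star P = P := (isStarProjection_eigenProj (gap R) μ).isSelfAdjoint.star_eq
  rcases hμ4.lt_or_eq with hlt | rfl
  · have hsin : 0 < Real.sin θ := by
      rw [hθ, Real.sin_arccos]
      exact Real.sqrt_pos.mpr (by nlinarith)
    have hC1 : Commute R P := commute_eigenProj_gap hR hR' μ
    have hC2 : Commute (star R) P := star_commute_eigenProj_gap hR hR' μ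
    have hadd : (R + star R) * P = (2 * Real.cos θ) • P := by
      rw [add_star_mul_eigenProj hR, hcos]
      congr 1
      ring
    set D := (R - star R) * P with hD
    have hDC : P * (R - star R) = D := (hC1.sub_left hC2).symm.eq
    have hDP : D * P = D := by rw [hD, mul_assoc, hPP]
    have hDstar : star D = -D := by
      rw [hD, star_mul, hPstar, star_sub, star_star, ← neg_sub, mul_neg, hDC]
    have hDD : D * D = (-(4 * Real.sin θ ^ 2)) • P := by
      have h1 : (R - star R) * (R - star R) =
          (R + star R) * (R + star R) - (4 : ℝ) • (1 : E →L[ℝ] E) := by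
        simp only [mul_sub, sub_mul, mul_add, add_mul, hR, hR']
        module
      calc D * D = (R - star R) * (P * (R - star R)) * P := by rw [hD]; noncomm_ring
        _ = (R - star R) * (R - star R) * P := by rw [hDC, hD]; simp only [mul_assoc, hPP]
        _ = (R + star R) * ((R + star R) * P) - (4 : ℝ) • P := by
            rw [h1, sub_mul, mul_assoc, smul_mul_assoc, one_mul]
        _ = (-(4 * Real.sin θ ^ 2)) • P := by
            rw [hadd, mul_smul_comm, hadd, smul_smul, ← sub_smul]
            congr 1
            rw [Real.sin_sq]
            ring
    have hBB : ((1 / (2 * Real.sin θ)) • D) * ((1 / (2 * Real.sin θ)) • D) = -P := by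
      rw [smul_mul_assoc, mul_smul_comm, hDD, smul_smul, smul_smul, ← neg_one_smul ℝ P]
      congr 1
      field_simp
      norm_num
    have hBP : ((1 / (2 * Real.sin θ)) • D) * P = (1 / (2 * Real.sin θ)) • D := by
      rw [smul_mul_assoc, hDP]
    refine ⟨(1 / (2 * Real.sin θ)) • D, ?_, hBB, hBP, hsuff _ hBB hBP ?_⟩
    · rw [star_smul, star_trivial, hDstar, smul_neg]
    · have h1 : R = (1 / 2 : ℝ) • (R + star R) + (1 / 2 : ℝ) • (R - star R) := by module
      have h2 : Real.sin θ * (1 / (2 * Real.sin θ)) = 1 / 2 := by field_simp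
      calc R * P = (1 / 2 : ℝ) • ((R + star R) * P) + (1 / 2 : ℝ) • D := by
            nth_rw 1 [h1]
            rw [add_mul, smul_mul_assoc, smul_mul_assoc]
        _ = _ := by
            rw [hadd, smul_smul, smul_smul, h2]
            congr 2
            ring
  · have := (gap R).finite_dimensional_eigenspace (isCompactOperator_gap hc) 4 four_ne_zero
    obtain ⟨B, h1, h2, h3⟩ :=
      exists_complexStructure (even_finrank_eigenspace_gap hR hR' hc hsign)
    refine ⟨B, h1, h2, h3, hsuff B h2 h3 ?_⟩
    have hθπ : θ = Real.pi := by
      rw [hθ]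
      norm_num
    have hRP : R * P = -P := by
      ext x
      exact apply_eq_neg_of_gap_eq hR (apply_eigenProj _ _ x)
    rw [hRP, hθπ, Real.cos_pi, Real.sin_pi]
    simp

end Orthogonal

/-! ### The rotation part as an infinite product -/

section Product

variable {H : Type*} [NormedAddCommGroup H] [InnerProductSpace ℝ H]

theorem partialProd_succ (J : Set ℕ) (F : ℕ → Op H) (n : ℕ) :
    partialProd J F (n + 1) = partialProd J F n * J.mulIndicator F n := by
  simp [partialProd, List.range_succ]

/-- If the factors agree with `R` on mutually orthogonal subspaces commuting with `R`, and are the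
identity on their orthogonal complements, then so do the partial products. -/
theorem partialProd_eq {J : Set ℕ} {F Q : ℕ → Op H} {R : Op H}
    (hF : ∀ j ∈ J, F j = 1 + (R - 1) * Q j) (hQ : ∀ j ∉ J, Q j = 0)
    (horth : ∀ i j, i ≠ j → Q i * Q j = 0) (hcomm : ∀ j, Commute R (Q j)) (n : ℕ) :
    partialProd J F n = 1 + (R - 1) * ∑ i ∈ Finset.range n, Q i := by
  induction n with
  | zero => simp [partialProd]
  | succ n ih =>
    have hval : J.mulIndicator F n = 1 + (R - 1) * Q n := by
      by_cases hn : n ∈ J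
      · rw [Set.mulIndicator_of_mem hn, hF n hn]
      · rw [Set.mulIndicator_of_notMem hn, hQ n hn, mul_zero, add_zero]
    set S := ∑ i ∈ Finset.range n, Q i with hS
    have hSQ : S * Q n = 0 := by
      rw [hS, Finset.sum_mul]
      exact Finset.sum_eq_zero fun i hi => horth i n (Finset.mem_range.mp hi).ne
    have hRS : S * (R - 1) = (R - 1) * S :=
      ((Commute.sum_right _ _ _ fun i _ => hcomm i).sub_left (Commute.one_left S)).eq.symm
    rw [partialProd_succ, ih, hval, Finset.sum_range_succ, ← hS]
    calc (1 + (R - 1) * S) * (1 + (R - 1) * Q n)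
        = 1 + (R - 1) * (S + Q n) + (R - 1) * (S * (R - 1)) * Q n := by noncomm_ring
      _ = 1 + (R - 1) * (S + Q n) + (R - 1) * (R - 1) * (S * Q n) := by rw [hRS]; noncomm_ring
      _ = _ := by rw [hSQ, mul_zero, add_zero]

variable [CompleteSpace H] {e : HilbertBasis ℕ ℝ H}

theorem isStarProjection_sum_of_orthogonal {Q : ℕ → Op H} (hQ : ∀ i, IsStarProjection (Q i))
    (horth : ∀ i j, i ≠ j → Q i * Q j = 0) (n : ℕ) :
    IsStarProjection (∑ i ∈ Finset.range n, Q i) := by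
  refine ⟨?_, ?_⟩
  · rw [IsIdempotentElem, Finset.sum_mul]
    refine Finset.sum_congr rfl fun i hi => ?_
    rw [Finset.mul_sum, Finset.sum_eq_single i (fun j _ hj => horth i j hj.symm)
      (fun h => absurd hi h), (hQ i).isIdempotentElem.eq]
  · rw [isSelfAdjoint_iff, star_sum]
    exact Finset.sum_congr rfl fun i _ => (hQ i).isSelfAdjoint.star_eq

open Module.End in
/-- A rotation is the product of the rotations `Exp (θ_j B_j)`, one for each positive eigenvalue
`2 - 2 cos θ_j` of `(R - 1)* (R - 1)`, taken in decreasing order. -/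
theorem IsRotation.exists_hasHSProd {R : Op H} (hR : IsRotation e R) :
    ∃ (J : Set ℕ) (B : ℕ → Op H) (θ : ℕ → ℝ),
      (∀ j ∈ J, B j ∈ sSpace e ∧ FiniteDimensional ℝ (B j).range) ∧
      (∀ j ∈ J, 0 < θ j ∧ θ j ≤ Real.pi) ∧ AntitoneOn θ J ∧
      (∀ k ∈ J, ∀ j ∈ J, k ≠ j → ⁅B k, B j⁆ = 0) ∧
      HasHSProd e J (fun j => NormedSpace.exp (θ j • B j)) R := by
  have hc : IsCompactOperator (R - 1 : Op H) := hR.isHS.isCompactOperator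
  have h1 := hR.star_mul_self
  have h2 := hR.mul_star_self
  have hgc := isCompactOperator_gap hc
  have hgs := isSelfAdjoint_gap R
  let M : Set ℝ := {μ | 0 < μ ∧ HasEigenvalue (gap R : Space H →ₗ[ℝ] Space H) μ}
  obtain ⟨J, g, hbij, hanti⟩ := exists_strictAntiOn_enumeration (M := M) (fun μ hμ => hμ.1)
    fun ε hε => (finite_eigenvalues hgs hgc hε).subset fun μ hμ => ⟨hμ.1.2, hμ.2⟩
  have hgM (j : ℕ) (hj : j ∈ J) : 0 < g j ∧ g j ≤ 4 :=
    ⟨(hbij.mapsTo hj).1, (eigenvalue_gap_mem h1 (hbij.mapsTo hj).2).2⟩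
  have hex (j : ℕ) (hj : j ∈ J) := exists_rotation_generator h1 h2 hc hR.sameSign (hgM j hj).1
    (hgM j hj).2
  choose! B hBstar hBB hBP hexp using hex
  set P : ℕ → Op H := fun j => eigenProj (gap R) (g j) with hP
  have hPB (j : ℕ) (hj : j ∈ J) : P j * B j = B j := by
    have h := congrArg star (hBP j hj)
    rw [star_mul, hBstar j hj, (isStarProjection_eigenProj _ _).isSelfAdjoint.star_eq, mul_neg,
      neg_inj] at h
    exact h
  have hPorth (i j : ℕ) (hi : i ∈ J) (hj : j ∈ J) (hij : i ≠ j) : P i * P j = 0 :=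
    eigenProj_mul_eigenProj hgs (hbij.injOn.ne hi hj hij)
  have hBorth (i j : ℕ) (hi : i ∈ J) (hj : j ∈ J) (hij : i ≠ j) : B i * B j = 0 := by
    calc B i * B j = B i * (P i * P j) * B j := by
          rw [← mul_assoc, hBP i hi, mul_assoc, hPB j hj]
      _ = 0 := by rw [hPorth i j hi hj hij, mul_zero, zero_mul]
  have hfin (j : ℕ) (hj : j ∈ J) :
      FiniteDimensional ℝ (eigenspace (gap R : Space H →ₗ[ℝ] Space H) (g j)) :=
    (gap R).finite_dimensional_eigenspace hgc (g j) (hgM j hj).1.ne'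
  refine ⟨J, B, fun j => Real.arccos (1 - g j / 2),
    fun j hj => ⟨mem_sSpace ?_ (hBstar j hj) ?_, ?_⟩,
    fun j hj => ⟨Real.arccos_pos.mpr (by linarith [(hgM j hj).1]), Real.arccos_le_pi _⟩,
    fun j hj k hk hjk => ?_, fun k hk j hj hkj => ?_, ?_⟩
  · have := hfin j hj
    rw [← hBP j hj]
    exact (isHS_starProjection e _).mul_left (B j)
  · -- `e_0` is fixed by `R`, hence orthogonal to the eigenspaces of nonzero eigenvalue
    have h0 : eigenProj (gap R) 0 (stdBasis e 0) = stdBasis e 0 := by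
      refine eigenProj_apply_of_eq ?_
      rw [gap, mul_apply_eq_comp, sub_apply, hR.apply_zero, one_apply_eq_self, sub_self, map_zero,
        zero_smul]
    have hz : P j (stdBasis e 0) = 0 := by
      rw [← h0, ← mul_apply_eq_comp, hP, eigenProj_mul_eigenProj hgs (hgM j hj).1.ne', zero_apply]
    rw [← hBP j hj, mul_apply_eq_comp, hz, map_zero]
  · have := hfin j hj
    refine Submodule.finiteDimensional_of_le
      (S₂ := eigenspace (gap R : Space H →ₗ[ℝ] Space H) (g j)) ?_
    rintro _ ⟨x, rfl⟩
    have h : B j x = P j (B j x) := by rw [← mul_apply_eq_comp, hPB j hj]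
    change B j x ∈ _
    rw [h]
    exact Submodule.starProjection_apply_mem _ _
  · refine Real.antitone_arccos ?_
    have := hanti.antitoneOn hj hk hjk
    linarith
  · rw [Ring.lie_def, hBorth k j hk hj hkj, hBorth j k hj hk hkj.symm, sub_self]
  let Q : ℕ → Op H := J.indicator P
  have hQ (i : ℕ) : IsStarProjection (Q i) := by
    by_cases hi : i ∈ J
    · simp only [Q, Set.indicator_of_mem hi]
      exact isStarProjection_eigenProj _ _
    · simp only [Q, Set.indicator_of_notMem hi]
      exact .zero _
  have hQorth (i j : ℕ) (hij : i ≠ j) : Q i * Q j = 0 := by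
    by_cases hi : i ∈ J
    · by_cases hj : j ∈ J
      · simp only [Q, Set.indicator_of_mem hi, Set.indicator_of_mem hj, hPorth i j hi hj hij]
      · simp only [Q, Set.indicator_of_notMem hj, mul_zero]
    · simp only [Q, Set.indicator_of_notMem hi, zero_mul]
  have hQcomm (i : ℕ) : Commute R (Q i) := by
    by_cases hi : i ∈ J
    · simp only [Q, Set.indicator_of_mem hi]
      exact commute_eigenProj_gap h1 h2 _
    · simp only [Q, Set.indicator_of_notMem hi, Commute.zero_right]
  set S : ℕ → Op H := fun n => ∑ i ∈ Finset.range n, Q i with hS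
  have hSproj (n : ℕ) : IsStarProjection (S n) := isStarProjection_sum_of_orthogonal hQ hQorth n
  have hSnorm (n : ℕ) : ‖S n - 1‖ ≤ 1 := by
    rw [norm_sub_rev]
    exact (hSproj n).one_sub.norm_le
  have hdiff (n : ℕ) :
      partialProd J (fun j => NormedSpace.exp (Real.arccos (1 - g j / 2) • B j)) n - R =
        (S n - 1) * (R - 1) := by
    rw [partialProd_eq (Q := Q) (R := R)
      (fun j hj => by rw [hexp j hj]; simp only [Q, Set.indicator_of_mem hj, hP])
      (fun j hj => Set.indicator_of_notMem hj P) hQorth hQcomm n]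
    have h : S n * (R - 1) = (R - 1) * S n :=
      ((Commute.sum_right _ _ _ fun i _ => hQcomm i).sub_left (Commute.one_left (S n))).eq.symm
    change 1 + (R - 1) * S n - R = (S n - 1) * (R - 1)
    rw [sub_mul (S n), h, one_mul]
    abel
  simp only [HasHSProd, hdiff]
  refine ⟨fun n => hR.isHS.mul_left _, tendsto_hsNorm_zero hR.isHS (fun n i => ?_) fun i => ?_⟩
  · simpa using (S n - 1).le_of_opNorm_le (hSnorm n) ((R - 1) (stdBasis e i))
  refine tendsto_zero_of_tendsto_on_eigenvectors (A := fun n => (S n - 1) * (R - 1))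
    (C := ‖R - 1‖) hgs hgc (fun n => ?_) (fun μ x hx => ?_) _
  · refine (norm_mul_le _ _).trans ?_
    simpa using mul_le_mul_of_nonneg_right (hSnorm n) (norm_nonneg (R - 1))
  · set w := (R - 1) x with hw
    have hw0 (h : w = 0) : Tendsto (fun n => ((S n - 1) * (R - 1)) x) atTop (𝓝 0) := by
      simp [mul_apply_eq_comp, ← hw, h]
    rcases eq_or_ne x 0 with rfl | hx0
    · exact hw0 (map_zero _)
    have hμ : HasEigenvalue (gap R : Space H →ₗ[ℝ] Space H) μ :=
      hasEigenvalue_of_hasEigenvector ⟨mem_eigenspace_iff.mpr hx, hx0⟩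
    rcases (eigenvalue_gap_mem h1 hμ).1.eq_or_lt with rfl | hμ0
    · refine hw0 (norm_eq_zero.mp (pow_eq_zero_iff two_ne_zero |>.mp ?_))
      rw [hw, ← real_inner_self_eq_norm_sq, ← inner_star_left, ← mul_apply_eq_comp, ← gap, hx,
        zero_smul, inner_zero_left]
    · obtain ⟨j, hj, rfl⟩ := hbij.surjOn ⟨hμ0, hμ⟩
      have hPx : P j x = x := eigenProj_apply_of_eq hx
      have hQj : Q j = P j := Set.indicator_of_mem hj P
      have hQw : Q j w = w := by
        have hcomm := (((hQcomm j).sub_left (Commute.one_left (Q j))).eq)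
        rw [hw, ← mul_apply_eq_comp, ← hcomm, mul_apply_eq_comp, hQj, hPx]
      refine tendsto_const_nhds.congr' ?_
      filter_upwards [eventually_gt_atTop j] with n hn
      have hSQ : S n * Q j = Q j := by
        rw [hS, Finset.sum_mul, Finset.sum_eq_single j (fun i _ hij => hQorth i j hij)
          (fun h => absurd (Finset.mem_range.mpr hn) h), (hQ j).isIdempotentElem.eq]
      rw [mul_apply_eq_comp, ← hw, sub_apply, one_apply_eq_self, ← hQw, ← mul_apply_eq_comp, hSQ,
        hQw, sub_self]

end Product

end HSLorentz

theorem mainTheorem3 {H : Type*} [NormedAddCommGroup H] [InnerProductSpace ℝ H] [CompleteSpace H]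
    (e : HilbertBasis ℕ ℝ H) (A : HSLorentz.Op H) (hA : A ∈ HSLorentz.SOHS e) :
    ∃ U ∈ HSLorentz.hSpace e, ∃ (J : Set ℕ) (B : ℕ → HSLorentz.Op H) (θ : ℕ → ℝ),
      (∀ j ∈ J, B j ∈ HSLorentz.sSpace e ∧ FiniteDimensional ℝ (B j).range) ∧
      (∀ j ∈ J, 0 < θ j ∧ θ j ≤ Real.pi) ∧
      AntitoneOn θ J ∧
      (∀ k ∈ J, ∀ j ∈ J, k ≠ j → ⁅B k, B j⁆ = 0) ∧
      ∃ P : HSLorentz.Op H,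
        HSLorentz.HasHSProd e J (fun j => NormedSpace.exp (θ j • B j)) P ∧
        A = P * NormedSpace.exp U := by
  obtain ⟨R, U, hR, hU, rfl⟩ := (HSLorentz.isProperLorentz_of_mem_SOHS hA).exists_polar hA.1
  obtain ⟨J, B, θ, hB, hθ, hanti, hcomm, hprod⟩ := hR.exists_hasHSProd
  exact ⟨U, hU, J, B, θ, hB, hθ, hanti, hcomm, R, hprod, rfl⟩
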